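/- Identify the Heisenberg group $\mathbb H^1$ with $\mathbb R^3$, with product $(x,y,t)*(x',y',t')=(x+x',\,y+y',\,t+t'+yx'-xy')$, left invariant fields $X=\partial_x+y\,\partial_t$, $Y=\partial_y-x\,\partial_t$, and Lebesgue measure as volume. For a measurable set $E$ and an open set $\Omega$, the perimeter is $$|\partial E|(\Omega)=\sup\Big\{\int_{E\cap\Omega}(Xf+Yg)\ :\ f,g\in C^1_c(\Omega),\ f^2+g^2\le 1\Big\}.$$ A measurable set $E$ is called area-minimizing if $|\partial E|(\Omega)<\infty$ for every bounded open $\Omega$, and $|\partial E|(\Omega)\le|\partial F|(\Omega)$ for every bounded open $\Omega$ and every measurable $F$ that agrees with $E$ outside a compact subset of $\Omega$. The graph of $u:\mathbb R^2\to\mathbb R$ is called area-minimizing if its subgraph $\{t<u(x,y)\}$ is. Let $L=\{(s\cos\theta,s\sin\theta):s\ge 0\}$ be a halfline from the origin of the $xy$-plane, and let $\alpha:[0,\infty)\to(0,\pi)$ be continuous and nonincreasing. For $s\ge 0$ let $L_s^{\pm}$ be the horizontal halflines $$L_s^\pm=\{(s\cos\theta,s\sin\theta,0)*(r\cos(\theta\pm\alpha(s)),\,r\sin(\theta\pm\alpha(s)),\,0):r\ge0\},$$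 which extend from the point of $L$ at distance $s$ from the origin and make the angles $\pm\alpha(s)$ with $L$. Let $W=\{(r\cos\varphi,r\sin\varphi):r\ge0,\ |\varphi-\theta|\le\alpha(0)\}$ be the closed wedge delimited by $L_0^+$ and $L_0^-$. Let $\Sigma$ be the union of all the halflines $L_s^\pm$, $s\ge0$, together with $\{(x,y,0):(x,y)\notin W\}$. Then $\Sigma$ is the graph of a function $u:\mathbb R^2\to\mathbb R$ which is locally Lipschitz in the Euclidean sense, and $\Sigma$ is area-minimizing. Its singular set projects exactly onto $L$: the points $(x,y)$ at which $u$ is differentiable with $\nabla u(x,y)=(y,-x)$ (that is, at which the tangent plane of the graph is horizontal) are precisely the points of $L$. If moreover $\alpha\equiv\alpha_0$ is constant, put $\beta_0=\cot\alpha_0$. Then the subgraph of $u$ is a cone with center $0$, that is, it is mapped into itself by $(x,y,t)\mapsto(e^{s}x,e^{s}y,e^{2s}t)$ for every $s\in\mathbb R$. In the coordinates in which $L$ is the positive $x$-axis, i.e. $\theta=0$ (for general $\theta$: after rotating the $xy$-plane by $\theta$), it is given by $$u(x,y)=\begin{cases}-xy+\beta_0\,y|y|,& x\ge\beta_0|y|,\\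 0,& x<\beta_0|y|.\end{cases}$$ Thus the surface consists of two pieces, patched together along the halflines $x=\beta_0|y|$: the plane $t=0$, and a piece of the graph of $-xy+\beta_0\,y|y|$, a function which is $C^{1}$ on $\mathbb R^2$ with Lipschitz derivative, and $C^\infty$ off the $x$-axis. -/

import Mathlib

open MeasureTheory Set
open scoped ENNReal NNReal

namespace Heis

/-- The underlying space of the Heisenberg group; a point is `(x, y, t)`. Its Haar (and Riemannian)
volume is Lebesgue measure `volume`. -/
abbrev Point : Type := ℝ × ℝ × ℝ

/-- The projection `(x, y, t) ↦ (x, y)`. -/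
def proj (p : Point) : ℝ × ℝ := (p.1, p.2.1)

/-- The product `[z, t] * [z', t'] = [z + z', t + t' + Im (z * conj z')]`. -/
def mul (p q : Point) : Point :=
  (p.1 + q.1, p.2.1 + q.2.1, p.2.2 + q.2.2 + (p.2.1 * q.1 - p.1 * q.2.1))

/-- The left invariant vector field `X = ∂_x + y ∂_t`. -/
def X (p : Point) : Point := (1, 0, p.2.1)

/-- The left invariant vector field `Y = ∂_y - x ∂_t`. -/
def Y (p : Point) : Point := (0, 1, -p.1)

/-- The divergence `X f + Y g` of the horizontal vector field `f X + g Y`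
(the fields `X` and `Y` are themselves divergence free). -/
noncomputable def horizontalDiv (f g : Point → ℝ) (p : Point) : ℝ :=
  fderiv ℝ f p (X p) + fderiv ℝ g p (Y p)

/-- `f X + g Y` is a `C¹` horizontal vector field with compact support inside `Ω` and with
modulus at most one (`X`, `Y` are orthonormal). -/
structure IsTestField (f g : Point → ℝ) (Ω : Set Point) : Prop where
  contDiff_fst : ContDiff ℝ 1 f
  contDiff_snd : ContDiff ℝ 1 g
  compact_fst : HasCompactSupport f
  compact_snd : HasCompactSupport g
  support_fst : tsupport f ⊆ Ω
  support_snd : tsupport g ⊆ Ω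
  norm_le : ∀ p, f p ^ 2 + g p ^ 2 ≤ 1

/-- The sub-Riemannian perimeter `|∂E|(Ω)` of `E` in `Ω`. -/
noncomputable def perimeter (E Ω : Set Point) : ℝ≥0∞ :=
  ⨆ (f : Point → ℝ) (g : Point → ℝ) (_ : IsTestField f g Ω),
    ENNReal.ofReal (∫ p in E ∩ Ω, horizontalDiv f g p)

/-- `E` is a (Lebesgue measurable) set of locally finite perimeter. -/
def LocallyFinitePerimeter (E : Set Point) : Prop :=
  NullMeasurableSet E (volume : Measure Point) ∧
    ∀ Ω : Set Point, IsOpen Ω → Bornology.IsBounded Ω → perimeter E Ω < ⊤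

/-- `E` minimizes perimeter in `Ω` among the measurable sets that agree with `E` outside some
compact subset of `Ω`. -/
def IsAreaMinimizingIn (E Ω : Set Point) : Prop :=
  ∀ F K : Set Point, NullMeasurableSet F (volume : Measure Point) →
    IsCompact K → K ⊆ Ω → E \ K = F \ K → perimeter E Ω ≤ perimeter F Ω

/-- `E` is area-minimizing (in the whole Heisenberg group): it has locally finite perimeter and is
area-minimizing in every bounded open set. -/
def IsAreaMinimizing (E : Set Point) : Prop :=
  LocallyFinitePerimeter E ∧
    ∀ Ω : Set Point, IsOpen Ω → Bornology.IsBounded Ω → IsAreaMinimizingIn E Ω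

/-- The `t`-graph of `u`. -/
def graph (u : ℝ × ℝ → ℝ) : Set Point := {p | p.2.2 = u (proj p)}

/-- The subgraph of `u`. -/
def subgraph (u : ℝ × ℝ → ℝ) : Set Point := {p | p.2.2 < u (proj p)}

/-- The projection to the `xy`-plane of the singular set of the graph of `u`: the points at which
`u` is differentiable and the tangent plane of the graph is the kernel of `-y dx + x dy + dt`. -/
def singularSet (u : ℝ × ℝ → ℝ) : Set (ℝ × ℝ) :=
  {q | HasFDerivAt u (q.2 • ContinuousLinearMap.fst ℝ ℝ ℝ - q.1 • ContinuousLinearMap.snd ℝ ℝ ℝ) q}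

/-- The planar halfline from the origin in the direction of angle `θ`. -/
def planarRay (θ : ℝ) : Set (ℝ × ℝ) :=
  {q | ∃ s : ℝ, 0 ≤ s ∧ q = (s * Real.cos θ, s * Real.sin θ)}

/-- The horizontal halfline extending from `p` with tangent vector `cos φ X + sin φ Y`. -/
def horizontalRay (p : Point) (φ : ℝ) : Set Point :=
  {q | ∃ r : ℝ, 0 ≤ r ∧ q = mul p (r * Real.cos φ, r * Real.sin φ, 0)}

/-- The closed wedge in the `xy`-plane with vertex at the origin, bisected by the direction `θ`,
and delimited by the halflines of directions `θ + a` and `θ - a`. -/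
def wedge (θ a : ℝ) : Set (ℝ × ℝ) :=
  {q | ∃ r φ : ℝ, 0 ≤ r ∧ |φ - θ| ≤ a ∧ q = (r * Real.cos φ, r * Real.sin φ)}

/-- The union of the horizontal halflines that extend from the points at distance `s ≥ 0` from the
origin on the halfline `L` of direction `θ`, making the angles `α s` and `-α s` with `L`. -/
def ruledSurface (θ : ℝ) (α : ℝ → ℝ) : Set Point :=
  ⋃ s ∈ Ici (0 : ℝ),
    horizontalRay (s * Real.cos θ, s * Real.sin θ, 0) (θ + α s) ∪
      horizontalRay (s * Real.cos θ, s * Real.sin θ, 0) (θ - α s)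

/-- The ruled surface, patched with the plane `t = 0` outside the wedge. -/
def patchedSurface (θ : ℝ) (α : ℝ → ℝ) : Set Point :=
  ruledSurface θ α ∪ {p | p.2.2 = 0 ∧ proj p ∉ wedge θ (α 0)}

/-- The dilation `(x, y, t) ↦ (e^s x, e^s y, e^{2s} t)`. -/
noncomputable def dilation (s : ℝ) (p : Point) : Point :=
  (Real.exp s * p.1, Real.exp s * p.2.1, Real.exp (2 * s) * p.2.2)

/-- `E` is a cone with center at the origin. -/
def IsCone (E : Set Point) : Prop := ∀ s : ℝ, dilation s '' E ⊆ E

/-- The function `-xy + β₀ y|y|`. -/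
def conePiece (b : ℝ) (q : ℝ × ℝ) : ℝ := -(q.1 * q.2) + b * (q.2 * |q.2|)

end Heis

/-! Let `x` be the coordinate along the direction `θ` and `y` the one across it. The rulings with
foot `(s, 0)` project to `x = s + |y| cot α(s)`, and their horizontal lifts have height `-s y`.
Since `cot ∘ α` is continuous and nondecreasing, for fixed `|y|` the right side increases strictly
and continuously in `s`. Hence a point of the wedge determines its foot `s`, and with `s = 0`
outside the wedge the surface is the graph of `u = -y s`. The same monotonicity makes `s` locally
Lipschitz. On `L` the product `-y s` agrees to first order with a horizontal plane, while off the
line `y = 0` the inequality `y ∂ₓu = -y² ∂ₓs ≤ 0` forbids a horizontal tangent plane.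

Minimality comes from a calibration. Let `ψ(q)` be the minimum over `s ≥ 0` of `|q - (s, 0)| + ∫₀ˢ
cos α`. As `cos ∘ α` is nondecreasing, the integral is convex in `s`, and the minimum is attained at
the foot of `q` (`potential_le`). So `ψ` is `1`-Lipschitz, and where it is differentiable off the
line `y = 0` its gradient is the unit vector of the ruling. The horizontal field `ψ_y X - ψ_x Y`
does not depend on `t`, and its divergence `ψ_yx - ψ_xy` vanishes as a distribution, even across
`L`, where the gradient may jump. The conormal of the subgraph annihilates the rulings, hence is a
multiple of this field; the sign of `y ∂ₓu` makes the multiple nonnegative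
(`calibration_ruledHeight`). The field is therefore a calibration, and
`isAreaMinimizing_of_calibration` concludes, using mollifications of `ψ` because `ψ` is only
Lipschitz. -/

namespace Heis

/-! ### Integration by parts over a Lipschitz subgraph -/

/-- The shear `((x, y), t) ↦ (x, y, t + u (x, y))`, which maps `{t < 0}` onto the subgraph of `u`. -/
def graphShear (u : ℝ × ℝ → ℝ) (z : (ℝ × ℝ) × ℝ) : Point := (z.1.1, z.1.2, z.2 + u z.1)

/-- The linear form `-(du) + y dx - x dy`, the horizontal conormal to the subgraph of `u`. -/
noncomputable def conormal (u : ℝ × ℝ → ℝ) (q v : ℝ × ℝ) : ℝ :=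
  q.2 * v.1 - q.1 * v.2 - fderiv ℝ u q v

/-- The shear as a homeomorphism. -/
def graphShearHomeomorph {u : ℝ × ℝ → ℝ} (hu : Continuous u) : (ℝ × ℝ) × ℝ ≃ₜ Point where
  toFun := graphShear u
  invFun p := ((p.1, p.2.1), p.2.2 - u (p.1, p.2.1))
  left_inv z := by simp [graphShear]
  right_inv p := by simp [graphShear]
  continuous_toFun := by unfold graphShear; fun_prop
  continuous_invFun := by fun_prop

theorem continuous_graphShear {u : ℝ × ℝ → ℝ} (hu : Continuous u) : Continuous (graphShear u) :=
  (graphShearHomeomorph hu).continuous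

theorem measurePreserving_graphShear {u : ℝ × ℝ → ℝ} (hu : Continuous u) :
    MeasurePreserving (graphShear u) volume volume := by
  have h1 : MeasurePreserving (fun z : (ℝ × ℝ) × ℝ => (z.1, z.2 + u z.1))
      ((volume : Measure (ℝ × ℝ)).prod (volume : Measure ℝ)) (volume.prod volume) := by
    refine (MeasurePreserving.id (volume : Measure (ℝ × ℝ))).skew_product
      (g := fun q t => t + u q) ?_ ?_
    · exact (show Continuous fun z : (ℝ × ℝ) × ℝ => z.2 + u z.1 by fun_prop).measurable
    · exact .of_forall fun q => (measurePreserving_add_right volume (u q)).map_eq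
  exact (volume_preserving_prodAssoc (α₁ := ℝ) (β₁ := ℝ) (γ₁ := ℝ)).comp h1

theorem measurableSet_subgraph {u : ℝ × ℝ → ℝ} (hu : Continuous u) :
    MeasurableSet (subgraph u) := by
  have : Continuous fun p : Point => u (proj p) := by unfold proj; fun_prop
  exact (isOpen_lt (by fun_prop) this).measurableSet

theorem graphShear_preimage_subgraph (u : ℝ × ℝ → ℝ) :
    graphShear u ⁻¹' subgraph u = univ ×ˢ Iio 0 := by
  ext z; simp [graphShear, subgraph, proj]

theorem setIntegral_subgraph {u : ℝ × ℝ → ℝ} (hu : Continuous u) {G : Point → ℝ}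
    (hG : Continuous G) :
    ∫ p in subgraph u, G p = ∫ z in (univ : Set (ℝ × ℝ)) ×ˢ Iio (0 : ℝ), G (graphShear u z) := by
  have h := measurePreserving_graphShear hu
  rw [← graphShear_preimage_subgraph u, ← setIntegral_map (measurableSet_subgraph hu)
    hG.aestronglyMeasurable h.measurable.aemeasurable, h.map_eq]

theorem _root_.HasCompactSupport.comp_prodMk_left {α β : Type*} [TopologicalSpace α]
    [TopologicalSpace β] [R1Space α] {F : α × β → ℝ} (hF : HasCompactSupport F) (b : β) :
    HasCompactSupport fun a => F (a, b) := by
  refine HasCompactSupport.intro' (hF.isCompact.image continuous_fst).closure isClosed_closure ?_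
  intro a ha
  by_contra hne
  exact ha (subset_closure ⟨(a, b), subset_tsupport _ hne, rfl⟩)

theorem _root_.HasCompactSupport.comp_prodMk_right {α β : Type*} [TopologicalSpace α]
    [TopologicalSpace β] [R1Space β] {F : α × β → ℝ} (hF : HasCompactSupport F) (a : α) :
    HasCompactSupport fun b => F (a, b) := by
  refine HasCompactSupport.intro' (hF.isCompact.image continuous_snd).closure isClosed_closure ?_
  intro b hb
  by_contra hne
  exact hb (subset_closure ⟨(a, b), subset_tsupport _ hne, rfl⟩)

/-- Integration by parts for Lipschitz functions, against the constant `1`. -/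
theorem integral_lineDeriv_eq_zero {C : ℝ≥0} {h : ℝ × ℝ → ℝ} (hl : LipschitzWith C h)
    (hc : HasCompactSupport h) (v : ℝ × ℝ) : ∫ q, lineDeriv ℝ h q v = 0 := by
  have := LipschitzWith.integral_lineDeriv_mul_eq (μ := volume)
    (LipschitzWith.const (1 : ℝ) : LipschitzWith 0 fun _ : ℝ × ℝ => (1 : ℝ)) hl hc (-v)
  simpa [lineDeriv] using this.symm

theorem lineDeriv_comp_graphShear {u : ℝ × ℝ → ℝ} {f : Point → ℝ} {q : ℝ × ℝ} (t : ℝ)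
    (hf : Differentiable ℝ f) (hu : DifferentiableAt ℝ u q) (v : ℝ × ℝ) :
    lineDeriv ℝ (fun q => f (graphShear u (q, t))) q v =
      fderiv ℝ f (graphShear u (q, t)) (v.1, v.2, fderiv ℝ u q v) := by
  have h1 : HasFDerivAt (fun q : ℝ × ℝ => graphShear u (q, t))
      ((ContinuousLinearMap.fst ℝ ℝ ℝ).prod ((ContinuousLinearMap.snd ℝ ℝ ℝ).prod (fderiv ℝ u q)))
      q :=
    hasFDerivAt_fst.prodMk (hasFDerivAt_snd.prodMk (hu.hasFDerivAt.const_add t))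
  have h2 := (hf (graphShear u (q, t))).hasFDerivAt.comp q h1
  have h3 := h2.hasLineDerivAt v
  exact h3.lineDeriv

theorem apply_vertical (L : Point →L[ℝ] ℝ) (a b c : ℝ) :
    L (a, b, c) = L (a, b, 0) + c * L (0, 0, 1) := by
  rw [← smul_eq_mul, ← map_smul, ← map_add]; simp

/-- The shear flattens the subgraph to `t < 0`. The horizontal vector over `v` is the tangent vector
`(v, du v)` plus `conormal u q v` times the vertical one. The tangential part is a derivative in `q`
of a compactly supported Lipschitz function at fixed `t`, so it integrates to zero; the vertical
part integrates in `t` to the boundary value of `f`. -/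
theorem setIntegral_subgraph_fderiv_of_lipschitz {C : ℝ≥0} {u : ℝ × ℝ → ℝ} (hu : LipschitzWith C u)
    {f : Point → ℝ} (hf : ContDiff ℝ 1 f) (hc : HasCompactSupport f) (v : ℝ × ℝ) :
    ∫ p in subgraph u, fderiv ℝ f p (v.1, v.2, p.2.1 * v.1 - p.1 * v.2) =
      ∫ q, conormal u q v * f (q.1, q.2, u q) := by
  have hfd : Continuous (fderiv ℝ f) := hf.continuous_fderiv one_ne_zero
  have hΦ := continuous_graphShear hu.continuous
  have hcΦ : ∀ {g : Point → ℝ}, HasCompactSupport g → HasCompactSupport (g ∘ graphShear u) :=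
    fun hg => hg.comp_homeomorph (graphShearHomeomorph hu.continuous)
  set A : (ℝ × ℝ) × ℝ → ℝ := fun z => fderiv ℝ f (graphShear u z) (v.1, v.2, 0) with hA
  set B : (ℝ × ℝ) × ℝ → ℝ := fun z => fderiv ℝ f (graphShear u z) (0, 0, 1) with hB
  have hAc : Continuous A := (hfd.comp hΦ).clm_apply continuous_const
  have hBc : Continuous B := (hfd.comp hΦ).clm_apply continuous_const
  have hAs : HasCompactSupport A := hcΦ (hc.fderiv_apply ℝ (v.1, v.2, 0))
  have hBs : HasCompactSupport B := hcΦ (hc.fderiv_apply ℝ (0, 0, 1))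
  have hAi : Integrable A := hAc.integrable_of_hasCompactSupport hAs
  have hBi : Integrable B := hBc.integrable_of_hasCompactSupport hBs
  have hdm : Measurable fun q => fderiv ℝ u q v := measurable_fderiv_apply_const ℝ u v
  have hdB : Integrable (fun z : (ℝ × ℝ) × ℝ => fderiv ℝ u z.1 v * B z) := by
    refine hBi.bdd_mul (c := C * ‖v‖) (hdm.comp measurable_fst).aestronglyMeasurable
      (.of_forall fun z => ?_)
    exact (ContinuousLinearMap.le_opNorm _ _).trans
      (mul_le_mul_of_nonneg_right (norm_fderiv_le_of_lipschitz ℝ hu) (norm_nonneg _))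
  -- The conormal is unbounded: its linear part is controlled by the compact support of `B`, its
  -- differential part by the Lipschitz constant.
  have hωB : Integrable (fun z : (ℝ × ℝ) × ℝ => conormal u z.1 v * B z) := by
    have h1 : Integrable (fun z : (ℝ × ℝ) × ℝ => (z.1.2 * v.1 - z.1.1 * v.2) * B z) :=
      (Continuous.mul (by fun_prop) hBc).integrable_of_hasCompactSupport hBs.mul_left
    refine (h1.sub hdB).congr (.of_forall fun z => ?_)
    simp only [conormal, Pi.sub_apply]; ring
  obtain ⟨D, hD⟩ := hf.lipschitzWith_of_hasCompactSupport hc one_ne_zero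
  have hzero : ∀ t, ∫ q, (A (q, t) + fderiv ℝ u q v * B (q, t)) = 0 := by
    intro t
    have hl : LipschitzWith (D * max 1 (max 1 C)) fun q => f (graphShear u (q, t)) := by
      refine hD.comp (LipschitzWith.prod_fst.prodMk (LipschitzWith.prod_snd.prodMk ?_))
      refine LipschitzWith.of_dist_le_mul fun a b => ?_
      simpa using hu.dist_le_mul a b
    rw [← integral_lineDeriv_eq_zero hl ((hcΦ hc).comp_prodMk_left t) v]
    refine integral_congr_ae ?_
    filter_upwards [hu.ae_differentiableAt] with q hq
    rw [lineDeriv_comp_graphShear t (hf.differentiable one_ne_zero) hq v,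
      apply_vertical]
  have hμ : (volume : Measure ((ℝ × ℝ) × ℝ)).restrict (univ ×ˢ Iio 0) =
      (volume : Measure (ℝ × ℝ)).prod (volume.restrict (Iio (0 : ℝ))) := by
    have h := Measure.prod_restrict (μ := (volume : Measure (ℝ × ℝ))) (ν := (volume : Measure ℝ))
      univ (Iio 0)
    rw [Measure.restrict_univ] at h
    exact h.symm
  have hGc : Continuous fun p : Point =>
      fderiv ℝ f p (v.1, v.2, p.2.1 * v.1 - p.1 * v.2) :=
    hfd.clm_apply (by fun_prop)
  rw [setIntegral_subgraph hu.continuous hGc]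
  have hsplit : ∀ z : (ℝ × ℝ) × ℝ, fderiv ℝ f (graphShear u z)
      (v.1, v.2, (graphShear u z).2.1 * v.1 - (graphShear u z).1 * v.2) =
      (A z + fderiv ℝ u z.1 v * B z) + conormal u z.1 v * B z := by
    intro z
    rw [apply_vertical]
    simp only [hA, hB, conormal, graphShear]; ring
  simp_rw [hsplit]
  have i1 : Integrable (fun z : (ℝ × ℝ) × ℝ => A z + fderiv ℝ u z.1 v * B z)
      ((volume : Measure (ℝ × ℝ)).prod (volume.restrict (Iio (0 : ℝ)))) := by
    rw [← hμ]; exact (hAi.add hdB).integrableOn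
  have i2 : Integrable (fun z : (ℝ × ℝ) × ℝ => conormal u z.1 v * B z)
      ((volume : Measure (ℝ × ℝ)).prod (volume.restrict (Iio (0 : ℝ)))) := by
    rw [← hμ]; exact hωB.integrableOn
  rw [hμ, integral_add i1 i2, integral_prod_symm _ i1, integral_prod _ i2]
  simp only [hzero, integral_zero, zero_add, integral_const_mul]
  refine integral_congr_ae (.of_forall fun q => ?_)
  dsimp only
  congr 1
  have hline : ContDiff ℝ 1 fun t => f (graphShear u (q, t)) :=
    hf.comp (g := f) (f := fun t => ((q.1, q.2, t + u q) : Point))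
      (contDiff_const.prodMk (contDiff_const.prodMk (contDiff_id.add contDiff_const)))
  have hderiv : ∀ t, deriv (fun t => f (graphShear u (q, t))) t = B (q, t) := by
    intro t
    have h1 : HasDerivAt (fun t => graphShear u (q, t)) ((0, 0, 1) : Point) t :=
      (hasDerivAt_const t q.1).prodMk ((hasDerivAt_const t q.2).prodMk
        ((hasDerivAt_id t).add_const (u q)))
    exact ((hf.differentiable one_ne_zero _).hasFDerivAt.comp_hasDerivAt t h1).deriv
  rw [← integral_Iic_eq_integral_Iio]
  simp_rw [← hderiv]
  rw [((hcΦ hc).comp_prodMk_right q : HasCompactSupport fun t => f (graphShear u (q, t))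
    ).integral_Iic_deriv_eq hline]
  simp [graphShear]

/-- Only the values of `u` over the projection of the support of `f` matter, so `u` may be replaced
by a globally Lipschitz extension from a ball. The open ball ensures that the derivatives agree as
well. -/
theorem setIntegral_subgraph_fderiv {u : ℝ × ℝ → ℝ} (hu : LocallyLipschitz u)
    {f : Point → ℝ} (hf : ContDiff ℝ 1 f) (hc : HasCompactSupport f) (v : ℝ × ℝ) :
    ∫ p in subgraph u, fderiv ℝ f p (v.1, v.2, p.2.1 * v.1 - p.1 * v.2) =
      ∫ q, conormal u q v * f (q.1, q.2, u q) := by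
  obtain ⟨R, hR⟩ := (hc.isCompact.image (show Continuous proj by unfold proj; fun_prop)
    ).isBounded.subset_ball 0
  obtain ⟨C, hC⟩ := (hu.locallyLipschitzOn (s := Metric.closedBall 0 R)
    ).exists_lipschitzOnWith_of_compact (isCompact_closedBall 0 R)
  obtain ⟨w, hw, hwu⟩ := hC.extend_real
  have hmem : ∀ p, proj p ∉ Metric.ball 0 R → p ∉ tsupport f :=
    fun p hp h => hp (hR (mem_image_of_mem _ h))
  have hEq : ∀ q ∈ Metric.ball (0 : ℝ × ℝ) R, u q = w q :=
    fun q hq => hwu (Metric.ball_subset_closedBall hq)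
  have h1 := setIntegral_subgraph_fderiv_of_lipschitz hw hf hc v
  rw [← integral_indicator (measurableSet_subgraph hw.continuous)] at h1
  rw [← integral_indicator (measurableSet_subgraph hu.continuous)]
  convert h1 using 1
  · refine integral_congr_ae (.of_forall fun p => ?_)
    by_cases hp : proj p ∈ Metric.ball 0 R
    · have : p ∈ subgraph u ↔ p ∈ subgraph w := by simp [subgraph, hEq _ hp]
      by_cases h : p ∈ subgraph w
      · rw [indicator_of_mem h, indicator_of_mem (this.2 h)]
      · rw [indicator_of_notMem h, indicator_of_notMem (mt this.1 h)]
    · have h0 : fderiv ℝ f p = 0 := by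
        by_contra hne
        exact hmem p hp (support_fderiv_subset ℝ hne)
      simp [indicator, h0]
  · refine integral_congr_ae (.of_forall fun q => ?_)
    by_cases hq : q ∈ Metric.ball 0 R
    · have : u =ᶠ[nhds q] w := by
        filter_upwards [Metric.isOpen_ball.mem_nhds hq] with z hz using hEq z hz
      simp only [conormal, this.fderiv_eq, this.eq_of_nhds]
    · have h0 : ∀ t, f (q.1, q.2, t) = 0 := fun t =>
        image_eq_zero_of_notMem_tsupport (hmem (q.1, q.2, t) hq)
      simp [h0]

/-! ### Euclidean 1-Lipschitz functions and their mollification -/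

open Filter Topology in
theorem fderiv_apply_le_of_euclidean_lipschitz {ψ : ℝ × ℝ → ℝ}
    (hψ : ∀ p q, |ψ p - ψ q| ≤ √((p.1 - q.1) ^ 2 + (p.2 - q.2) ^ 2)) (q v : ℝ × ℝ) :
    fderiv ℝ ψ q v ≤ √(v.1 ^ 2 + v.2 ^ 2) := by
  by_cases hd : DifferentiableAt ℝ ψ q
  · have h1 : HasDerivAt (fun t : ℝ => ψ (q + t • v)) (fderiv ℝ ψ q v) 0 :=
      hd.hasFDerivAt.hasLineDerivAt v
    refine (le_abs_self _).trans (h1.le_of_lip' (Real.sqrt_nonneg _) (.of_forall fun t => ?_))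
    refine (hψ _ _).trans (le_of_eq ?_)
    rw [← Real.sqrt_sq (norm_nonneg (t - 0)), ← Real.sqrt_mul (by positivity)]
    congr 1
    simp only [sub_zero, Real.norm_eq_abs, sq_abs, Prod.fst_add, Prod.snd_add, Prod.smul_fst,
      Prod.smul_snd, smul_eq_mul, zero_mul]
    ring
  -- The default value `0` of `fderiv` makes the bound hold at every point, so that it can be
  -- averaged.
  · rw [fderiv_zero_of_not_differentiableAt hd]; simp

/-- The product carries the sup norm; the constant `2` dominates the comparison factor `√2`. -/
theorem lipschitzWith_of_euclidean_lipschitz {ψ : ℝ × ℝ → ℝ}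
    (hψ : ∀ p q, |ψ p - ψ q| ≤ √((p.1 - q.1) ^ 2 + (p.2 - q.2) ^ 2)) : LipschitzWith 2 ψ := by
  refine LipschitzWith.of_dist_le_mul fun p q => ?_
  refine (hψ p q).trans (Real.sqrt_le_iff.2 ⟨by positivity, ?_⟩)
  have h1 : |p.1 - q.1| ≤ dist p q := le_max_left _ _
  have h2 : |p.2 - q.2| ≤ dist p q := le_max_right _ _
  rw [← sq_abs (p.1 - q.1), ← sq_abs (p.2 - q.2)]
  push_cast
  nlinarith [abs_nonneg (p.1 - q.1), abs_nonneg (p.2 - q.2)]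

/-- A family of bumps at the origin whose supports shrink to it. -/
noncomputable def shrinkingBump (k : ℕ) : ContDiffBump (0 : ℝ × ℝ) where
  rIn := 1 / ((k : ℝ) + 1)
  rOut := 2 * (1 / ((k : ℝ) + 1))
  rIn_pos := by positivity
  rIn_lt_rOut := by
    have : 0 < 1 / ((k : ℝ) + 1) := by positivity
    linarith

open Convolution in
/-- The mollification of `g` by `shrinkingBump k`. -/
noncomputable def mollify (k : ℕ) (g : ℝ × ℝ → ℝ) : ℝ × ℝ → ℝ :=
  ((shrinkingBump k).normed volume ⋆[ContinuousLinearMap.lsmul ℝ ℝ, volume] g)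

theorem contDiff_mollify (k : ℕ) {g : ℝ × ℝ → ℝ} (hg : Continuous g) :
    ContDiff ℝ 2 (mollify k g) :=
  (shrinkingBump k).hasCompactSupport_normed.contDiff_convolution_left (n := 2) _
    (shrinkingBump k).contDiff_normed hg.locallyIntegrable

/-- Differentiation under the integral: Rademacher's theorem gives the derivative of the integrand
for almost every `t`, and the Lipschitz constant gives the domination. -/
theorem fderiv_mollify (k : ℕ) {C : ℝ≥0} {ψ : ℝ × ℝ → ℝ} (hψ : LipschitzWith C ψ)
    (q v : ℝ × ℝ) :
    fderiv ℝ (mollify k ψ) q v = mollify k (fun z => fderiv ℝ ψ z v) q := by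
  set ρ : ℝ × ℝ → ℝ := (shrinkingBump k).normed volume with hρ
  have hρc : Continuous ρ := (shrinkingBump k).continuous_normed
  have hρi : Integrable ρ := (shrinkingBump k).integrable_normed
  have hFc : ∀ x, Continuous fun t => ρ t • ψ (x - t) := fun x =>
    hρc.smul (hψ.continuous.comp (by fun_prop))
  have key := hasFDerivAt_integral_of_dominated_loc_of_lip' (μ := (volume : Measure (ℝ × ℝ)))
    (F := fun x t => ρ t • ψ (x - t)) (F' := fun t => ρ t • fderiv ℝ ψ (q - t)) (x₀ := q)
    (bound := fun t => |ρ t| * C) Filter.univ_mem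
    (fun x _ => (hFc x).aestronglyMeasurable)
    ((hFc q).integrable_of_hasCompactSupport
      ((shrinkingBump k).hasCompactSupport_normed.smul_right))
    (hρc.measurable.smul ((measurable_fderiv ℝ ψ).comp (by fun_prop))).aestronglyMeasurable
    (.of_forall fun t x _ => ?_) (hρi.abs.mul_const _) ?_
  · have h2 : HasFDerivAt (mollify k ψ) (∫ t, ρ t • fderiv ℝ ψ (q - t)) q := key.2
    rw [h2.fderiv, ContinuousLinearMap.integral_apply key.1]
    rfl
  · rw [← smul_sub, norm_smul, mul_assoc, Real.norm_eq_abs]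
    refine mul_le_mul_of_nonneg_left ?_ (abs_nonneg _)
    simpa using hψ.norm_sub_le (x - t) (q - t)
  · have h := (Measure.measurePreserving_sub_left (volume : Measure (ℝ × ℝ)) q
      ).quasiMeasurePreserving.ae hψ.ae_differentiableAt
    filter_upwards [h] with t ht
    have h1 := ht.hasFDerivAt.comp q ((hasFDerivAt_id q).sub_const t)
    rw [ContinuousLinearMap.comp_id] at h1
    exact h1.const_smul (ρ t)

-- Lebesgue differentiation, applied to the bounded function `fderiv ℝ ψ · v`; `K = 2` is the ratio
-- of the radii of `shrinkingBump`.
open Filter Topology in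
theorem ae_tendsto_fderiv_mollify {C : ℝ≥0} {ψ : ℝ × ℝ → ℝ} (hψ : LipschitzWith C ψ)
    (v : ℝ × ℝ) :
    ∀ᵐ q, Tendsto (fun k => fderiv ℝ (mollify k ψ) q v) atTop (𝓝 (fderiv ℝ ψ q v)) := by
  simp_rw [fun k => fderiv_mollify k hψ]
  refine ContDiffBump.ae_convolution_tendsto_right_of_locallyIntegrable (K := 2)
    (φ := shrinkingBump) ?_ (.of_forall fun k => le_rfl) ?_
  · simpa [shrinkingBump] using (tendsto_one_div_add_atTop_nhds_zero_nat (𝕜 := ℝ)).const_mul 2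
  · refine (memLp_top_of_bound (measurable_fderiv_apply_const ℝ ψ v).aestronglyMeasurable
      (C * ‖v‖) (.of_forall fun q => ?_)).locallyIntegrable le_top
    exact (ContinuousLinearMap.le_opNorm _ _).trans
      (mul_le_mul_of_nonneg_right (norm_fderiv_le_of_lipschitz ℝ hψ) (norm_nonneg _))

/-- An average of linear forms of Euclidean norm at most one again has norm at most one. -/
theorem fderiv_mollify_le {ψ : ℝ × ℝ → ℝ}
    (hψ : ∀ p q, |ψ p - ψ q| ≤ √((p.1 - q.1) ^ 2 + (p.2 - q.2) ^ 2)) (k : ℕ) (q v : ℝ × ℝ) :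
    fderiv ℝ (mollify k ψ) q v ≤ √(v.1 ^ 2 + v.2 ^ 2) := by
  have hl := lipschitzWith_of_euclidean_lipschitz hψ
  rw [fderiv_mollify k hl]
  have hρi := (shrinkingBump k).integrable_normed (μ := volume)
  have hb : ∀ z, ‖fderiv ℝ ψ z v‖ ≤ 2 * ‖v‖ := fun z =>
    (ContinuousLinearMap.le_opNorm _ _).trans
      (mul_le_mul_of_nonneg_right (norm_fderiv_le_of_lipschitz ℝ hl) (norm_nonneg _))
  calc mollify k (fun z => fderiv ℝ ψ z v) q
      ≤ ∫ t, (shrinkingBump k).normed volume t * √(v.1 ^ 2 + v.2 ^ 2) := by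
        refine integral_mono ?_ (hρi.mul_const _) fun t => ?_
        · refine hρi.mul_bdd (c := 2 * ‖v‖) ?_ (.of_forall fun t => hb _)
          exact ((measurable_fderiv_apply_const ℝ ψ v).comp
            (measurable_const.sub measurable_id)).aestronglyMeasurable
        · exact mul_le_mul_of_nonneg_left (fderiv_apply_le_of_euclidean_lipschitz hψ _ _)
            ((shrinkingBump k).nonneg_normed t)
    _ = √(v.1 ^ 2 + v.2 ^ 2) := by
        rw [integral_mul_const, (shrinkingBump k).integral_normed, one_mul]

/-! ### Horizontal divergence and perimeter of a subgraph -/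

theorem continuous_proj : Continuous proj := by unfold proj; fun_prop

theorem conormal_eq (u : ℝ × ℝ → ℝ) (q : ℝ × ℝ) (a b : ℝ) :
    conormal u q (a, b) = a * conormal u q (1, 0) + b * conormal u q (0, 1) := by
  have h : fderiv ℝ u q (a, b) = a * fderiv ℝ u q (1, 0) + b * fderiv ℝ u q (0, 1) := by
    rw [← smul_eq_mul, ← smul_eq_mul, ← map_smul, ← map_smul, ← map_add]; simp
  simp only [conormal, h]; ring

theorem measurable_conormal (u : ℝ × ℝ → ℝ) (v : ℝ × ℝ) : Measurable fun q => conormal u q v := by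
  unfold conormal
  exact (by fun_prop : Measurable fun q : ℝ × ℝ => q.2 * v.1 - q.1 * v.2).sub
    (measurable_fderiv_apply_const ℝ u v)

theorem exists_conormal_bound {u : ℝ × ℝ → ℝ} (hu : LocallyLipschitz u) (R : ℝ) :
    ∃ C, 0 ≤ C ∧ ∀ q ∈ Metric.ball (0 : ℝ × ℝ) R, ∀ v, |conormal u q v| ≤ C * ‖v‖ := by
  obtain ⟨C, hC⟩ := (hu.locallyLipschitzOn (s := Metric.closedBall 0 R)
    ).exists_lipschitzOnWith_of_compact (isCompact_closedBall 0 R)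
  refine ⟨2 * |R| + C, by positivity, fun q hq v => ?_⟩
  have hqR : ‖q‖ ≤ |R| := (mem_ball_zero_iff.1 hq).le.trans (le_abs_self R)
  have h1 : |q.2 * v.1| ≤ |R| * ‖v‖ := by
    rw [abs_mul]
    exact mul_le_mul ((norm_snd_le q).trans hqR) (norm_fst_le v) (abs_nonneg _) (abs_nonneg _)
  have h2 : |q.1 * v.2| ≤ |R| * ‖v‖ := by
    rw [abs_mul]
    exact mul_le_mul ((norm_fst_le q).trans hqR) (norm_snd_le v) (abs_nonneg _) (abs_nonneg _)
  have h3 : |fderiv ℝ u q v| ≤ C * ‖v‖ :=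
    (ContinuousLinearMap.le_opNorm _ _).trans (mul_le_mul_of_nonneg_right
      (norm_fderiv_le_of_lipschitzOn ℝ (Filter.mem_of_superset (Metric.isOpen_ball.mem_nhds hq)
        Metric.ball_subset_closedBall) hC) (norm_nonneg _))
  unfold conormal
  rw [abs_le] at *
  constructor <;> linarith

theorem integrable_conormal_mul {u : ℝ × ℝ → ℝ} (hu : LocallyLipschitz u) {f : Point → ℝ}
    (hf : Continuous f) (hc : HasCompactSupport f) (v : ℝ × ℝ) :
    Integrable fun q => conormal u q v * f (q.1, q.2, u q) := by
  obtain ⟨R, hR⟩ := (hc.isCompact.image continuous_proj).isBounded.subset_ball 0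
  obtain ⟨C, hC0, hC⟩ := exists_conormal_bound hu R
  have hf0 : ∀ q ∉ Metric.ball (0 : ℝ × ℝ) R, f (q.1, q.2, u q) = 0 := fun q hq =>
    image_eq_zero_of_notMem_tsupport
      fun h => hq (hR (mem_image_of_mem proj h : proj (q.1, q.2, u q) ∈ _))
  have hgc : Continuous fun q : ℝ × ℝ => f (q.1, q.2, u q) :=
    hf.comp (continuous_fst.prodMk (continuous_snd.prodMk hu.continuous))
  have hgs : HasCompactSupport fun q : ℝ × ℝ => f (q.1, q.2, u q) :=
    HasCompactSupport.intro (isCompact_closedBall 0 R)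
      fun q hq => hf0 q fun h => hq (Metric.ball_subset_closedBall h)
  refine ((hgc.integrable_of_hasCompactSupport hgs).norm.const_mul (C * ‖v‖)).mono'
    ((measurable_conormal u v).mul hgc.measurable).aestronglyMeasurable (.of_forall fun q => ?_)
  rw [norm_mul]
  by_cases hq : q ∈ Metric.ball (0 : ℝ × ℝ) R
  · exact mul_le_mul_of_nonneg_right (hC q hq v) (norm_nonneg _)
  · rw [hf0 q hq]; simp

theorem integral_horizontalDiv_subgraph {u : ℝ × ℝ → ℝ} (hu : LocallyLipschitz u) {f g : Point → ℝ}
    (hf : ContDiff ℝ 1 f) (hfc : HasCompactSupport f) (hg : ContDiff ℝ 1 g)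
    (hgc : HasCompactSupport g) :
    ∫ p in subgraph u, horizontalDiv f g p =
      ∫ q, conormal u q (f (q.1, q.2, u q), g (q.1, q.2, u q)) := by
  have hX : Continuous fun p => fderiv ℝ f p (X p) :=
    (hf.continuous_fderiv one_ne_zero).clm_apply (by unfold X; fun_prop)
  have hY : Continuous fun p => fderiv ℝ g p (Y p) :=
    (hg.continuous_fderiv one_ne_zero).clm_apply (by unfold Y; fun_prop)
  have hXs : HasCompactSupport fun p => fderiv ℝ f p (X p) :=
    (hfc.fderiv ℝ).mono fun p hp h => hp (by simp [h])
  have hYs : HasCompactSupport fun p => fderiv ℝ g p (Y p) :=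
    (hgc.fderiv ℝ).mono fun p hp h => hp (by simp [h])
  have h1 := setIntegral_subgraph_fderiv hu hf hfc (1, 0)
  have h2 := setIntegral_subgraph_fderiv hu hg hgc (0, 1)
  simp_rw [conormal_eq u _ (f _) (g _)]
  simp only [horizontalDiv]
  rw [integral_add (hX.integrable_of_hasCompactSupport hXs).integrableOn
    (hY.integrable_of_hasCompactSupport hYs).integrableOn]
  simp_rw [mul_comm (f _), mul_comm (g _)]
  rw [integral_add (integrable_conormal_mul hu hf.continuous hfc _)
    (integrable_conormal_mul hu hg.continuous hgc _), ← h1, ← h2]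
  simp [X, Y]

theorem horizontalDiv_eq_zero {f g : Point → ℝ} {p : Point} (hf : p ∉ tsupport f)
    (hg : p ∉ tsupport g) : horizontalDiv f g p = 0 := by
  have h1 : fderiv ℝ f p = 0 := by
    by_contra h; exact hf (support_fderiv_subset ℝ h)
  have h2 : fderiv ℝ g p = 0 := by
    by_contra h; exact hg (support_fderiv_subset ℝ h)
  simp [horizontalDiv, h1, h2]

theorem IsTestField.setIntegral_inter {f g : Point → ℝ} {E Ω : Set Point} (h : IsTestField f g Ω)
    (hE : MeasurableSet E) :
    ∫ p in E ∩ Ω, horizontalDiv f g p = ∫ p in E, horizontalDiv f g p := by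
  refine (setIntegral_eq_of_subset_of_forall_sdiff_eq_zero hE inter_subset_left
    fun p hp => ?_).symm
  have hpΩ : p ∉ Ω := fun hΩ => hp.2 ⟨hp.1, hΩ⟩
  exact horizontalDiv_eq_zero (fun hf => hpΩ (h.support_fst hf)) fun hg => hpΩ (h.support_snd hg)

theorem IsTestField.setIntegral_subgraph_inter {u : ℝ × ℝ → ℝ} (hu : LocallyLipschitz u)
    {f g : Point → ℝ} {Ω : Set Point} (h : IsTestField f g Ω) :
    ∫ p in subgraph u ∩ Ω, horizontalDiv f g p =
      ∫ q, conormal u q (f (q.1, q.2, u q), g (q.1, q.2, u q)) := by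
  rw [h.setIntegral_inter (measurableSet_subgraph hu.continuous),
    integral_horizontalDiv_subgraph hu h.contDiff_fst h.compact_fst h.contDiff_snd h.compact_snd]

theorem IsTestField.ofReal_le_perimeter {f g : Point → ℝ} {Ω : Set Point}
    (h : IsTestField f g Ω) (E : Set Point) :
    ENNReal.ofReal (∫ p in E ∩ Ω, horizontalDiv f g p) ≤ perimeter E Ω :=
  le_iSup_of_le f (le_iSup_of_le g (le_iSup_of_le h le_rfl))

theorem locallyFinitePerimeter_subgraph {u : ℝ × ℝ → ℝ} (hu : LocallyLipschitz u) :
    LocallyFinitePerimeter (subgraph u) := by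
  refine ⟨(measurableSet_subgraph hu.continuous).nullMeasurableSet, fun Ω _ hΩ => ?_⟩
  obtain ⟨R, hR⟩ := hΩ.subset_ball 0
  obtain ⟨C, hC0, hC⟩ := exists_conormal_bound hu R
  refine lt_of_le_of_lt (iSup_le fun f => iSup_le fun g => iSup_le fun h => ?_)
    (ENNReal.ofReal_lt_top (r := C * volume.real (Metric.ball (0 : ℝ × ℝ) R)))
  refine ENNReal.ofReal_le_ofReal ?_
  rw [h.setIntegral_subgraph_inter hu]
  -- A graph point over the complement of the ball lies outside `Ω`, where test fields vanish.
  have hout : ∀ q ∉ Metric.ball (0 : ℝ × ℝ) R,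
      conormal u q (f (q.1, q.2, u q), g (q.1, q.2, u q)) = 0 := by
    intro q hq
    have hp : ((q.1, q.2, u q) : Point) ∉ Ω := fun hp => hq <| by
      have h1 := mem_ball_zero_iff.1 (hR hp)
      refine mem_ball_zero_iff.2 (lt_of_le_of_lt ?_ h1)
      exact max_le_max le_rfl (le_max_left _ _)
    rw [image_eq_zero_of_notMem_tsupport fun hf => hp (h.support_fst hf),
      image_eq_zero_of_notMem_tsupport fun hg => hp (h.support_snd hg)]
    rw [conormal_eq]; simp
  rw [← setIntegral_eq_integral_of_forall_compl_eq_zero hout]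
  refine (Real.le_norm_self _).trans (norm_setIntegral_le_of_norm_le_const
    Metric.isBounded_ball.measure_lt_top fun q hq => ?_)
  refine (hC q hq _).trans (mul_le_of_le_one_right hC0 (max_le ?_ ?_))
  · have := h.norm_le (q.1, q.2, u q)
    exact (abs_le_one_iff_mul_self_le_one.2 (by nlinarith [sq_nonneg (g (q.1, q.2, u q))]))
  · have := h.norm_le (q.1, q.2, u q)
    exact (abs_le_one_iff_mul_self_le_one.2 (by nlinarith [sq_nonneg (f (q.1, q.2, u q))]))

/-! ### The calibration argument -/

open Topology in
theorem exists_contDiff_cutoff {K Ω : Set Point} (hK : IsCompact K) (hΩ : IsOpen Ω) (h : K ⊆ Ω) :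
    ∃ χ : Point → ℝ, ContDiff ℝ 1 χ ∧ HasCompactSupport χ ∧ tsupport χ ⊆ Ω ∧
      (∀ p ∈ K, χ =ᶠ[𝓝 p] fun _ => 1) ∧ ∀ p, χ p ∈ Icc (0 : ℝ) 1 := by
  obtain ⟨K', hK', hKK', hK'Ω⟩ := exists_compact_between hK hΩ h
  obtain ⟨χ, h1, h0, hI⟩ := exists_contMDiffMap_one_nhds_of_subset_interior
    (n := 1) (modelWithCornersSelf ℝ Point) hK.isClosed hKK'
  have hsub : tsupport χ ⊆ K' := closure_minimal
    (fun p hp => by_contra fun hn => hp (h0 p hn)) hK'.isClosed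
  exact ⟨χ, χ.contMDiff.contDiff, hK'.of_isClosed_subset (isClosed_tsupport _) hsub,
    hsub.trans hK'Ω, fun p hp => Filter.Eventually.filter_mono (nhds_le_nhdsSet hp) h1, hI⟩

theorem setIntegral_eq_of_diff_eq {E F K : Set Point} {G : Point → ℝ}
    (hE : NullMeasurableSet E (volume : Measure Point))
    (hF : NullMeasurableSet F (volume : Measure Point)) (hEF : E \ K = F \ K)
    (hG : ∀ p ∈ K, G p = 0) : ∫ p in E, G p = ∫ p in F, G p := by
  rw [← integral_indicator₀ hE, ← integral_indicator₀ hF]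
  congr 1
  ext p
  by_cases hp : p ∈ K
  · simp [indicator, hG p hp]
  · have : p ∈ E ↔ p ∈ F := by
      have := Set.ext_iff.1 hEF p
      simpa [hp] using this
    by_cases h : p ∈ F
    · rw [indicator_of_mem h, indicator_of_mem (this.2 h)]
    · rw [indicator_of_notMem h, indicator_of_notMem (mt this.1 h)]

/-- The components of the horizontal field `χ (Ψ_y X - Ψ_x Y)`. -/
noncomputable def cutoffField (χ : Point → ℝ) (Ψ : ℝ × ℝ → ℝ) (v : ℝ × ℝ) (p : Point) : ℝ :=
  χ p * fderiv ℝ Ψ (proj p) v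

theorem contDiff_cutoffField {χ : Point → ℝ} {Ψ : ℝ × ℝ → ℝ} (hχ : ContDiff ℝ 1 χ)
    (hΨ : ContDiff ℝ 2 Ψ) (v : ℝ × ℝ) : ContDiff ℝ 1 (cutoffField χ Ψ v) := by
  have h1 : ContDiff ℝ 1 (fderiv ℝ Ψ) := hΨ.fderiv_right (by norm_num)
  have h2 : ContDiff ℝ 1 proj := by unfold proj; fun_prop
  exact hχ.mul ((h1.comp h2).clm_apply contDiff_const)

theorem sq_add_sq_le_one_of_fderiv_le {L : ℝ × ℝ →L[ℝ] ℝ}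
    (hL : ∀ v, L v ≤ √(v.1 ^ 2 + v.2 ^ 2)) : L (0, 1) ^ 2 + L (1, 0) ^ 2 ≤ 1 := by
  set a := L (1, 0)
  set b := L (0, 1)
  -- The bound is tested on the gradient `(a, b)` itself.
  have h1 : L (a, b) = a ^ 2 + b ^ 2 := by
    have : ((a, b) : ℝ × ℝ) = a • (1, 0) + b • (0, 1) := by simp
    rw [this, map_add, map_smul, map_smul, smul_eq_mul, smul_eq_mul]; ring
  have h2 := hL (a, b)
  rw [h1] at h2
  have h3 : 0 ≤ √(a ^ 2 + b ^ 2) := Real.sqrt_nonneg _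
  have h4 : √(a ^ 2 + b ^ 2) ^ 2 = a ^ 2 + b ^ 2 := Real.sq_sqrt (by positivity)
  dsimp only at h2
  have h5 : √(a ^ 2 + b ^ 2) ≤ 1 := by
    by_contra! h; nlinarith
  nlinarith

theorem isTestField_cutoffField {χ : Point → ℝ} {Ψ : ℝ × ℝ → ℝ} {Ω : Set Point}
    (hχ : ContDiff ℝ 1 χ) (hχc : HasCompactSupport χ) (hχΩ : tsupport χ ⊆ Ω)
    (hχI : ∀ p, χ p ∈ Icc (0 : ℝ) 1) (hΨ : ContDiff ℝ 2 Ψ)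
    (hΨ1 : ∀ q v, fderiv ℝ Ψ q v ≤ √(v.1 ^ 2 + v.2 ^ 2)) :
    IsTestField (cutoffField χ Ψ (0, 1)) (fun p => -cutoffField χ Ψ (1, 0) p) Ω := by
  have hs : ∀ v, tsupport (cutoffField χ Ψ v) ⊆ tsupport χ := fun v =>
    closure_mono fun p hp h => hp (by simp [cutoffField, h])
  have hsn : ∀ v, tsupport (fun p => -cutoffField χ Ψ v p) ⊆ tsupport χ := fun v =>
    closure_mono fun p hp h => hp (by simp [cutoffField, h])
  refine ⟨contDiff_cutoffField hχ hΨ _, (contDiff_cutoffField hχ hΨ _).neg, ?_, ?_,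
    (hs _).trans hχΩ, (hsn _).trans hχΩ, fun p => ?_⟩
  · exact hχc.of_isClosed_subset (isClosed_tsupport _) (hs _)
  · exact hχc.of_isClosed_subset (isClosed_tsupport _) (hsn _)
  · have h1 := sq_add_sq_le_one_of_fderiv_le (hΨ1 (proj p))
    have h2 := hχI p
    have h3 : χ p ^ 2 ≤ 1 := by nlinarith [h2.1, h2.2]
    simp only [cutoffField]
    nlinarith [sq_nonneg (χ p)]

-- Where the cutoff is locally `1` the field depends on `(x, y)` only, and its divergence is a
-- difference of mixed second derivatives of `Ψ`.
open Topology in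
theorem horizontalDiv_cutoffField {χ : Point → ℝ} {Ψ : ℝ × ℝ → ℝ} {p : Point}
    (hχ : χ =ᶠ[𝓝 p] fun _ => 1) (hΨ : ContDiff ℝ 2 Ψ) :
    horizontalDiv (cutoffField χ Ψ (0, 1)) (fun p => -cutoffField χ Ψ (1, 0) p) p = 0 := by
  have hd : ∀ v, HasFDerivAt (cutoffField χ Ψ v)
      (((fderiv ℝ (fderiv ℝ Ψ) (proj p)).flip v).comp
        ((ContinuousLinearMap.fst ℝ ℝ (ℝ × ℝ)).prod
          ((ContinuousLinearMap.fst ℝ ℝ ℝ).comp (ContinuousLinearMap.snd ℝ ℝ (ℝ × ℝ))))) p := by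
    intro v
    have h1 : HasFDerivAt proj ((ContinuousLinearMap.fst ℝ ℝ (ℝ × ℝ)).prod
          ((ContinuousLinearMap.fst ℝ ℝ ℝ).comp (ContinuousLinearMap.snd ℝ ℝ (ℝ × ℝ)))) p :=
      hasFDerivAt_fst.prodMk (hasFDerivAt_fst.comp p hasFDerivAt_snd)
    have h2 : HasFDerivAt (fderiv ℝ Ψ) (fderiv ℝ (fderiv ℝ Ψ) (proj p)) (proj p) :=
      ((hΨ.fderiv_right (m := 1) (by norm_num)).differentiable one_ne_zero _).hasFDerivAt
    have h3 := (ContinuousLinearMap.apply ℝ ℝ v).hasFDerivAt.comp p (h2.comp p h1)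
    refine HasFDerivAt.congr_of_eventuallyEq h3 ?_
    filter_upwards [hχ] with z hz
    simp [cutoffField, hz]
  have hsymm : IsSymmSndFDerivAt ℝ Ψ (proj p) :=
    hΨ.contDiffAt.isSymmSndFDerivAt (by simp)
  have hs := hsymm (1, 0) (0, 1)
  unfold horizontalDiv
  rw [(hd _).fderiv, (hd (1, 0)).fun_neg.fderiv]
  simp only [X, Y, neg_apply, ContinuousLinearMap.comp_apply,
    ContinuousLinearMap.prod_apply, ContinuousLinearMap.flip_apply, ContinuousLinearMap.coe_fst',
    ContinuousLinearMap.coe_snd']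
  rw [hs]; ring

open Filter Topology in
/-- A graph whose conormal is everywhere maximal in the direction of the rotated gradient of a
`1`-Lipschitz function of the plane is calibrated by it, hence area-minimizing. -/
theorem isAreaMinimizing_of_calibration {u ψ : ℝ × ℝ → ℝ} (hu : LocallyLipschitz u)
    (hψ : ∀ p q, |ψ p - ψ q| ≤ √((p.1 - q.1) ^ 2 + (p.2 - q.2) ^ 2))
    (hcal : ∀ᵐ q, ∀ a b : ℝ, a ^ 2 + b ^ 2 ≤ 1 →
      conormal u q (a, b) ≤ conormal u q (fderiv ℝ ψ q (0, 1), -fderiv ℝ ψ q (1, 0))) :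
    IsAreaMinimizing (subgraph u) := by
  refine ⟨locallyFinitePerimeter_subgraph hu, fun Ω hΩ _ F K hF hK hKΩ hEF => ?_⟩
  refine iSup_le fun f => iSup_le fun g => iSup_le fun h => ?_
  -- The cutoff is `1` near `K`, so the field is divergence free wherever `F` may differ from the
  -- subgraph, and near the supports of `f` and `g`, where it must dominate them.
  obtain ⟨χ, hχ, hχc, hχΩ, hχ1, hχI⟩ := exists_contDiff_cutoff
    ((hK.union h.compact_fst.isCompact).union h.compact_snd.isCompact) hΩ
    (union_subset (union_subset hKΩ h.support_fst) h.support_snd)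
  have hl := lipschitzWith_of_euclidean_lipschitz hψ
  have hE := (measurableSet_subgraph hu.continuous).nullMeasurableSet (μ := volume)
  have hsm : ∀ k, ContDiff ℝ 2 (mollify k ψ) := fun k => contDiff_mollify k hl.continuous
  have htest : ∀ k, IsTestField (cutoffField χ (mollify k ψ) (0, 1))
      (fun p => -cutoffField χ (mollify k ψ) (1, 0) p) Ω := fun k =>
    isTestField_cutoffField hχ hχc hχΩ hχI (hsm k) (fderiv_mollify_le hψ k)
  -- The flux of the cut-off field is the same for the subgraph and for `F`, because its divergence
  -- vanishes on `K`.
  have hle : ∀ k, ENNReal.ofReal (∫ q, conormal u q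
      (cutoffField χ (mollify k ψ) (0, 1) (q.1, q.2, u q),
        -cutoffField χ (mollify k ψ) (1, 0) (q.1, q.2, u q))) ≤ perimeter F Ω := by
    intro k
    rw [← (htest k).setIntegral_subgraph_inter hu, setIntegral_eq_of_diff_eq
      (hE.inter hΩ.measurableSet.nullMeasurableSet) (hF.inter hΩ.measurableSet.nullMeasurableSet)
      (K := K)]
    · exact (htest k).ofReal_le_perimeter F
    · ext p
      have := Set.ext_iff.1 hEF p
      simp only [Set.mem_sdiff, mem_inter_iff] at this ⊢
      tauto
    · exact fun p hp => horizontalDiv_cutoffField (hχ1 p (Or.inl (Or.inl hp))) (hsm k)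
  have hab : ∀ q, fderiv ℝ ψ q (0, 1) ^ 2 + fderiv ℝ ψ q (1, 0) ^ 2 ≤ 1 := fun q =>
    sq_add_sq_le_one_of_fderiv_le (fderiv_apply_le_of_euclidean_lipschitz hψ q)
  have habk : ∀ k q, fderiv ℝ (mollify k ψ) q (0, 1) ^ 2 +
      fderiv ℝ (mollify k ψ) q (1, 0) ^ 2 ≤ 1 := fun k q =>
    sq_add_sq_le_one_of_fderiv_le (fderiv_mollify_le hψ k q)
  have hi := fun v => integrable_conormal_mul hu hχ.continuous hχc v
  have hlim : Tendsto (fun k => ∫ q, conormal u q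
      (cutoffField χ (mollify k ψ) (0, 1) (q.1, q.2, u q),
        -cutoffField χ (mollify k ψ) (1, 0) (q.1, q.2, u q))) atTop
      (𝓝 (∫ q, conormal u q (cutoffField χ ψ (0, 1) (q.1, q.2, u q),
        -cutoffField χ ψ (1, 0) (q.1, q.2, u q)))) := by
    refine tendsto_integral_of_dominated_convergence
      (fun q => |conormal u q (1, 0) * χ (q.1, q.2, u q)| +
        |conormal u q (0, 1) * χ (q.1, q.2, u q)|) (fun k => ?_) ((hi _).abs.add (hi _).abs)
      (fun k => .of_forall fun q => ?_) ?_
    · exact ((integrable_conormal_mul hu (htest k).contDiff_fst.continuous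
        (htest k).compact_fst (1, 0)).add (integrable_conormal_mul hu
        (htest k).contDiff_snd.continuous (htest k).compact_snd (0, 1))).aestronglyMeasurable.congr
        (.of_forall fun q => by
          simp only [Pi.add_apply]; rw [conormal_eq u q (cutoffField _ _ _ _)]; ring)
    · have h1 := habk k q
      have ha : |fderiv ℝ (mollify k ψ) q (0, 1)| ≤ 1 :=
        abs_le_one_iff_mul_self_le_one.2 (by nlinarith)
      have hb : |fderiv ℝ (mollify k ψ) q (1, 0)| ≤ 1 :=
        abs_le_one_iff_mul_self_le_one.2 (by nlinarith)
      rw [conormal_eq u q (cutoffField _ _ _ _), Real.norm_eq_abs]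
      refine (abs_add_le _ _).trans (add_le_add ?_ ?_)
      · simp only [cutoffField, proj, abs_mul]
        nlinarith [mul_nonneg (abs_nonneg (χ (q.1, q.2, u q))) (abs_nonneg (conormal u q (1, 0)))]
      · simp only [cutoffField, proj, abs_mul, abs_neg]
        nlinarith [mul_nonneg (abs_nonneg (χ (q.1, q.2, u q))) (abs_nonneg (conormal u q (0, 1)))]
    · filter_upwards [ae_tendsto_fderiv_mollify hl (0, 1), ae_tendsto_fderiv_mollify hl (1, 0)]
        with q h1 h2
      simp_rw [conormal_eq u q (cutoffField _ _ _ _)]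
      exact ((h1.const_mul _).mul_const _).add ((h2.const_mul _).neg.mul_const _)
  refine le_trans (ENNReal.ofReal_le_ofReal ?_)
    (le_of_tendsto' ((ENNReal.continuous_ofReal.tendsto _).comp hlim) hle)
  rw [h.setIntegral_subgraph_inter hu]
  refine integral_mono_ae ?_ ?_ ?_
  · exact ((integrable_conormal_mul hu h.contDiff_fst.continuous
      h.compact_fst (1, 0)).add (integrable_conormal_mul hu
      h.contDiff_snd.continuous h.compact_snd (0, 1))).congr (.of_forall fun q => by
        simp only [Pi.add_apply]; rw [conormal_eq u q (f _)]; ring)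
  · have hm := fun v => (measurable_fderiv_apply_const ℝ ψ v).aestronglyMeasurable (μ := volume)
    refine (((hi (1, 0)).mul_bdd (c := 1) (hm (0, 1)) (.of_forall fun q => ?_)).sub
      ((hi (0, 1)).mul_bdd (c := 1) (hm (1, 0)) (.of_forall fun q => ?_))).congr
      (.of_forall fun q => ?_)
    · exact abs_le_one_iff_mul_self_le_one.2 (by nlinarith [hab q])
    · exact abs_le_one_iff_mul_self_le_one.2 (by nlinarith [hab q])
    · simp only [Pi.sub_apply]
      rw [conormal_eq u q (cutoffField _ _ _ _)]
      simp only [cutoffField, proj]; ring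
  · filter_upwards [hcal] with q hq
    have hscale : conormal u q (cutoffField χ ψ (0, 1) (q.1, q.2, u q),
        -cutoffField χ ψ (1, 0) (q.1, q.2, u q)) = χ (q.1, q.2, u q) *
        conormal u q (fderiv ℝ ψ q (0, 1), -fderiv ℝ ψ q (1, 0)) := by
      rw [conormal_eq, conormal_eq u q (fderiv ℝ ψ q (0, 1))]
      simp only [cutoffField, proj]; ring
    rw [hscale]
    by_cases hp : ((q.1, q.2, u q) : Point) ∈ tsupport f ∪ tsupport g
    · have : χ (q.1, q.2, u q) = 1 :=
        (hχ1 _ (hp.elim (fun h => Or.inl (Or.inr h)) Or.inr)).eq_of_nhds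
      rw [this, one_mul]
      exact hq _ _ (h.norm_le _)
    · rw [image_eq_zero_of_notMem_tsupport fun hf => hp (Or.inl hf),
        image_eq_zero_of_notMem_tsupport fun hg => hp (Or.inr hg)]
      -- Off the supports of `f` and `g` the cutoff may lie strictly between `0` and `1`; comparison
      -- with the zero vector shows that the calibrated value is nonnegative.
      have h0 := hq 0 0 (by norm_num)
      have hz : conormal u q (0, 0) = 0 := by rw [conormal_eq]; simp
      rw [hz] at h0 ⊢
      exact mul_nonneg (hχI _).1 h0

/-! ### Angle functions and the foot of a ruling -/

/-- `α` is an admissible angle function: continuous, nonincreasing, with values in `(0, π)`. -/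
structure IsAngleFunction (α : ℝ → ℝ) : Prop where
  continuousOn : ContinuousOn α (Ici 0)
  antitoneOn : AntitoneOn α (Ici 0)
  mem_Ioo : ∀ s : ℝ, 0 ≤ s → α s ∈ Ioo 0 Real.pi

namespace IsAngleFunction

variable {α : ℝ → ℝ}

theorem sin_pos (hα : IsAngleFunction α) {s : ℝ} (hs : 0 ≤ s) : 0 < Real.sin (α s) :=
  Real.sin_pos_of_mem_Ioo (hα.mem_Ioo s hs)

theorem monotoneOn_cot (hα : IsAngleFunction α) :
    MonotoneOn (fun s => Real.cot (α s)) (Ici 0) := by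
  intro s hs t ht hst
  simp only [Real.cot_eq_cos_div_sin]
  rw [div_le_div_iff₀ (hα.sin_pos hs) (hα.sin_pos ht)]
  have h := Real.sin_nonneg_of_nonneg_of_le_pi (sub_nonneg.2 (hα.antitoneOn hs ht hst))
    (by linarith [(hα.mem_Ioo s hs).2, (hα.mem_Ioo t ht).1])
  rw [Real.sin_sub] at h
  linarith

theorem continuousOn_cot (hα : IsAngleFunction α) :
    ContinuousOn (fun s => Real.cot (α s)) (Ici 0) := by
  simp only [Real.cot_eq_cos_div_sin]
  exact (Real.continuous_cos.comp_continuousOn hα.continuousOn).div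
    (Real.continuous_sin.comp_continuousOn hα.continuousOn) fun s hs => (hα.sin_pos hs).ne'

theorem continuousOn_cos (hα : IsAngleFunction α) :
    ContinuousOn (fun s => Real.cos (α s)) (Ici 0) :=
  Real.continuous_cos.comp_continuousOn hα.continuousOn

theorem monotoneOn_cos (hα : IsAngleFunction α) :
    MonotoneOn (fun s => Real.cos (α s)) (Ici 0) := fun s hs t ht hst =>
  Real.cos_le_cos_of_nonneg_of_le_pi (hα.mem_Ioo t ht).1.le (hα.mem_Ioo s hs).2.le
    (hα.antitoneOn hs ht hst)

end IsAngleFunction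

/-- `s` is the abscissa of the foot on the positive `x`-axis of the ruling through `(x, w)`, `w ≥ 0`,
where the ruling from `(s, 0)` is `x = s + w * β s`; points to the left of the first ruling are
assigned the foot `0`. -/
structure IsFoot (β : ℝ → ℝ) (x w s : ℝ) : Prop where
  nonneg : 0 ≤ s
  le : x ≤ s + w * β s
  eq : 0 < s → s + w * β s = x

section Foot

variable {β : ℝ → ℝ} {x w s : ℝ}

theorem exists_isFoot (hc : ContinuousOn β (Ici 0)) (hm : MonotoneOn β (Ici 0)) (x : ℝ)
    (hw : 0 ≤ w) : ∃ s, IsFoot β x w s := by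
  rcases le_or_gt x (w * β 0) with h | h
  · exact ⟨0, le_rfl, by simpa using h, fun h => absurd h (lt_irrefl _)⟩
  have h1 : 0 ≤ x - w * β 0 := by linarith
  have hcont : ContinuousOn (fun s => s + w * β s) (Icc 0 (x - w * β 0)) :=
    continuousOn_id.add (continuousOn_const.mul (hc.mono Icc_subset_Ici_self))
  have h2 := mul_le_mul_of_nonneg_left (hm (mem_Ici.2 le_rfl) (mem_Ici.2 h1) h1) hw
  obtain ⟨s, hs, hsx⟩ := intermediate_value_Icc h1 hcont
    (show x ∈ Icc _ _ from ⟨by linarith, by linarith⟩)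
  exact ⟨s, hs.1, hsx.ge, fun _ => hsx⟩

/-- If `s > s'`, then `x = s + w β(s) ≥ s + w β(s')`, whereas `x' ≤ s' + w' β(s')`; subtract. No
regularity of `β` beyond monotonicity enters. -/
theorem IsFoot.sub_le (hm : MonotoneOn β (Ici 0)) {x' w' s' : ℝ} (h : IsFoot β x w s)
    (h' : IsFoot β x' w' s') (hw : 0 ≤ w) : s - s' ≤ |x - x'| + |w - w'| * |β s'| := by
  rcases le_or_gt s s' with hs | hs
  · exact (sub_nonpos.2 hs).trans (by positivity)
  have h1 := h.eq (h'.nonneg.trans_lt hs)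
  have h2 := h'.le
  have h3 := mul_le_mul_of_nonneg_left (hm (mem_Ici.2 h'.nonneg) (mem_Ici.2 h.nonneg) hs.le) hw
  have h4 : (w' - w) * β s' ≤ |w - w'| * |β s'| := by
    rw [abs_sub_comm, ← abs_mul]; exact le_abs_self _
  linarith [le_abs_self (x - x')]

theorem IsFoot.unique (hm : MonotoneOn β (Ici 0)) {s' : ℝ} (h : IsFoot β x w s)
    (h' : IsFoot β x w s') (hw : 0 ≤ w) : s = s' := by
  have h1 := h.sub_le hm h' hw
  have h2 := h'.sub_le hm h hw
  simp only [sub_self, abs_zero, zero_mul, add_zero] at h1 h2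
  linarith

theorem IsFoot.mono (hm : MonotoneOn β (Ici 0)) {x' s' : ℝ} (h : IsFoot β x w s)
    (h' : IsFoot β x' w s') (hw : 0 ≤ w) (hx : x ≤ x') : s ≤ s' := by
  by_contra! hs
  have h1 := h.eq (h'.nonneg.trans_lt hs)
  have h2 := h'.le
  have h3 := mul_le_mul_of_nonneg_left (hm (mem_Ici.2 h'.nonneg) (mem_Ici.2 h.nonneg) hs.le) hw
  linarith

/-- A homothety centred at the foot preserves the ruling, and for `s = 0` also the region to the
left of the first ruling. -/
theorem IsFoot.ray (h : IsFoot β x w s) {r : ℝ} (hr : 0 < r) :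
    IsFoot β (s + r * (x - s)) (r * w) s := by
  refine ⟨h.nonneg, ?_, fun hs => ?_⟩
  · nlinarith [mul_le_mul_of_nonneg_left h.le hr.le]
  · rw [← h.eq hs]; ring

theorem IsFoot.le_bound (hm : MonotoneOn β (Ici 0)) (h : IsFoot β x w s) (hw : 0 ≤ w) :
    s ≤ |x| + w * |β 0| := by
  rcases h.nonneg.eq_or_lt with hs | hs
  · rw [← hs]; positivity
  · have h1 := h.eq hs
    have h2 := mul_le_mul_of_nonneg_left (hm (mem_Ici.2 le_rfl) (mem_Ici.2 h.nonneg) h.nonneg) hw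
    have h3 := mul_le_mul_of_nonneg_left (neg_abs_le (β 0)) hw
    linarith [le_abs_self x]

end Foot

/-! ### Adapted coordinates and the height function -/

/-- The coordinate of `q` along the direction `θ`. -/
noncomputable def along (θ : ℝ) (q : ℝ × ℝ) : ℝ := q.1 * Real.cos θ + q.2 * Real.sin θ

/-- The coordinate of `q` across the direction `θ`. -/
noncomputable def across (θ : ℝ) (q : ℝ × ℝ) : ℝ := q.2 * Real.cos θ - q.1 * Real.sin θ

open Classical in
/-- The abscissa on the halfline of direction `θ` of the foot of the ruling through `q`. -/
noncomputable def foot (θ : ℝ) (α : ℝ → ℝ) (q : ℝ × ℝ) : ℝ :=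
  if h : ∃ s, IsFoot (fun s => Real.cot (α s)) (along θ q) |across θ q| s then h.choose else 0

/-- The function whose graph is the patched ruled surface. -/
noncomputable def ruledHeight (θ : ℝ) (α : ℝ → ℝ) (q : ℝ × ℝ) : ℝ := -(across θ q * foot θ α q)

section Height

variable {θ : ℝ} {α : ℝ → ℝ}

theorem isFoot_foot (hα : IsAngleFunction α) (q : ℝ × ℝ) :
    IsFoot (fun s => Real.cot (α s)) (along θ q) |across θ q| (foot θ α q) := by
  have h := exists_isFoot hα.continuousOn_cot hα.monotoneOn_cot (along θ q)
    (abs_nonneg (across θ q))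
  rw [foot, dif_pos h]
  exact h.choose_spec

theorem foot_eq (hα : IsAngleFunction α) {q : ℝ × ℝ} {s : ℝ}
    (h : IsFoot (fun s => Real.cot (α s)) (along θ q) |across θ q| s) : foot θ α q = s :=
  (isFoot_foot hα q).unique hα.monotoneOn_cot h (abs_nonneg _)

theorem fst_eq (θ : ℝ) (q : ℝ × ℝ) :
    q.1 = along θ q * Real.cos θ - across θ q * Real.sin θ := by
  simp only [along, across]
  linear_combination -q.1 * Real.sin_sq_add_cos_sq θ

theorem snd_eq (θ : ℝ) (q : ℝ × ℝ) :
    q.2 = along θ q * Real.sin θ + across θ q * Real.cos θ := by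
  simp only [along, across]
  linear_combination -q.2 * Real.sin_sq_add_cos_sq θ

theorem ext_along_across {p q : ℝ × ℝ} (h1 : along θ p = along θ q)
    (h2 : across θ p = across θ q) : p = q := by
  ext
  · rw [fst_eq θ p, fst_eq θ q, h1, h2]
  · rw [snd_eq θ p, snd_eq θ q, h1, h2]

theorem abs_along_le (θ : ℝ) (q : ℝ × ℝ) : |along θ q| ≤ 2 * ‖q‖ := by
  have h1 := norm_fst_le q
  have h2 := norm_snd_le q
  refine (abs_add_le _ _).trans ?_
  rw [abs_mul, abs_mul]
  rw [Real.norm_eq_abs] at h1 h2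
  nlinarith [Real.abs_cos_le_one θ, Real.abs_sin_le_one θ, abs_nonneg q.1, abs_nonneg q.2,
    abs_nonneg (Real.cos θ), abs_nonneg (Real.sin θ)]

theorem abs_across_le (θ : ℝ) (q : ℝ × ℝ) : |across θ q| ≤ 2 * ‖q‖ := by
  have h1 := norm_fst_le q
  have h2 := norm_snd_le q
  refine (abs_sub _ _).trans ?_
  rw [abs_mul, abs_mul]
  rw [Real.norm_eq_abs] at h1 h2
  nlinarith [Real.abs_cos_le_one θ, Real.abs_sin_le_one θ, abs_nonneg q.1, abs_nonneg q.2,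
    abs_nonneg (Real.cos θ), abs_nonneg (Real.sin θ)]

theorem along_sub (p q : ℝ × ℝ) : along θ (p - q) = along θ p - along θ q := by
  simp only [along, Prod.fst_sub, Prod.snd_sub]; ring

theorem across_sub (p q : ℝ × ℝ) : across θ (p - q) = across θ p - across θ q := by
  simp only [across, Prod.fst_sub, Prod.snd_sub]; ring

/-- On a ball the feet stay in `[0, T]`, where `cot ∘ α` is bounded by its values at the two ends;
`IsFoot.sub_le` then gives a Lipschitz constant. -/
theorem foot_bounds (hα : IsAngleFunction α) (M : ℝ) :
    ∃ T C : ℝ, 0 ≤ T ∧ 0 ≤ C ∧ (∀ q ∈ Metric.ball (0 : ℝ × ℝ) M, foot θ α q ≤ T) ∧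
      ∀ p ∈ Metric.ball (0 : ℝ × ℝ) M, ∀ q ∈ Metric.ball (0 : ℝ × ℝ) M,
        |foot θ α p - foot θ α q| ≤ C * dist p q := by
  set β : ℝ → ℝ := fun s => Real.cot (α s) with hβ
  have hm : MonotoneOn β (Ici 0) := hα.monotoneOn_cot
  set T := 2 * |M| + 2 * |M| * |β 0|
  set B := max |β 0| |β T|
  have hT : 0 ≤ T := by positivity
  have hfT : ∀ q ∈ Metric.ball (0 : ℝ × ℝ) M, foot θ α q ≤ T := by
    intro q hq
    have hqM : ‖q‖ ≤ |M| := (mem_ball_zero_iff.1 hq).le.trans (le_abs_self M)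
    refine ((isFoot_foot hα q).le_bound hm (abs_nonneg _)).trans (add_le_add ?_ ?_)
    · exact (abs_along_le θ q).trans (by linarith)
    · exact mul_le_mul_of_nonneg_right ((abs_across_le θ q).trans (by linarith)) (abs_nonneg _)
  have hB : ∀ q ∈ Metric.ball (0 : ℝ × ℝ) M, |β (foot θ α q)| ≤ B := by
    intro q hq
    have h0 := (isFoot_foot hα q (θ := θ)).nonneg
    exact abs_le_max_abs_abs (hm (mem_Ici.2 le_rfl) (mem_Ici.2 h0) h0)
      (hm (mem_Ici.2 h0) (mem_Ici.2 hT) (hfT q hq))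
  have hsub : ∀ p ∈ Metric.ball (0 : ℝ × ℝ) M, ∀ q ∈ Metric.ball (0 : ℝ × ℝ) M,
      foot θ α p - foot θ α q ≤ (2 + 2 * B) * dist p q := by
    intro p hp q hq
    refine ((isFoot_foot hα p).sub_le hm (isFoot_foot hα q) (abs_nonneg _)).trans ?_
    have h1 : |along θ p - along θ q| ≤ 2 * dist p q := by
      rw [← along_sub, dist_eq_norm]; exact abs_along_le θ _
    have h2 : |(|across θ p| - |across θ q|)| ≤ 2 * dist p q := by
      refine (abs_abs_sub_abs_le _ _).trans ?_
      rw [← across_sub, dist_eq_norm]; exact abs_across_le θ _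
    have h3 := mul_le_mul h2 (hB q hq) (abs_nonneg _) (by positivity)
    linarith
  refine ⟨T, 2 + 2 * B, hT, by positivity, hfT, fun p hp q hq => abs_sub_le_iff.2
    ⟨hsub p hp q hq, ?_⟩⟩
  rw [dist_comm]
  exact hsub q hq p hp

theorem locallyLipschitz_ruledHeight (hα : IsAngleFunction α) :
    LocallyLipschitz (ruledHeight θ α) := by
  intro q₀
  set M := ‖q₀‖ + 1
  obtain ⟨T, C, hT, hC, hfT, hfC⟩ := foot_bounds (θ := θ) hα M
  have hM : 0 ≤ M := by positivity
  refine ⟨⟨2 * M * C + T * 2, by positivity⟩, Metric.ball 0 M,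
    Metric.isOpen_ball.mem_nhds (mem_ball_zero_iff.2 (lt_add_one _)),
    LipschitzOnWith.of_dist_le_mul fun p hp q hq => ?_⟩
  have h1 : |across θ p| ≤ 2 * M :=
    (abs_across_le θ p).trans (by linarith [mem_ball_zero_iff.1 hp])
  have h2 := hfC p hp q hq
  have h3 : |across θ p - across θ q| ≤ 2 * dist p q := by
    rw [← across_sub, dist_eq_norm]; exact abs_across_le θ _
  have h4 : |foot θ α q| ≤ T := by
    rw [abs_of_nonneg (isFoot_foot hα q).nonneg]; exact hfT q hq
  have h5 : ruledHeight θ α p - ruledHeight θ α q = -(across θ p * (foot θ α p - foot θ α q)) -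
      foot θ α q * (across θ p - across θ q) := by
    simp only [ruledHeight]; ring
  rw [Real.dist_eq, h5]
  refine (abs_sub _ _).trans ?_
  rw [abs_neg, abs_mul, abs_mul]
  have h6 := mul_le_mul h1 h2 (abs_nonneg _) (by positivity)
  have h7 := mul_le_mul h4 h3 (abs_nonneg _) hT
  change _ ≤ (2 * M * C + T * 2) * dist p q
  linarith

/-! ### The patched surface as a graph -/

theorem foot_eq_zero (hα : IsAngleFunction α) {q : ℝ × ℝ}
    (h : along θ q ≤ |across θ q| * Real.cot (α 0)) : foot θ α q = 0 :=
  foot_eq hα ⟨le_rfl, by simpa using h, fun h => absurd h (lt_irrefl _)⟩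

/-- In polar coordinates, with `δ` the angle from `L` and `|δ| ≤ π`, the inequality says that `r
sin(α(0) - |δ|) ≥ 0`. Since `α(0) - |δ|` lies strictly between `-π` and `π`, for `r > 0` this means
`|δ| ≤ α(0)`. -/
theorem mem_wedge_iff (hα : IsAngleFunction α) (q : ℝ × ℝ) :
    q ∈ wedge θ (α 0) ↔ |across θ q| * Real.cot (α 0) ≤ along θ q := by
  have hs := hα.sin_pos le_rfl
  have hr := hα.mem_Ioo 0 le_rfl
  have key : ∀ r δ : ℝ, |r * Real.sin δ| * Real.cot (α 0) ≤ r * Real.cos δ ↔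
      0 ≤ r * Real.cos δ * Real.sin (α 0) - |r * Real.sin δ| * Real.cos (α 0) := by
    intro r δ
    rw [Real.cot_eq_cos_div_sin, mul_div_assoc', div_le_iff₀ hs, sub_nonneg]
  have hpolar : ∀ r φ : ℝ, along θ (r * Real.cos φ, r * Real.sin φ) = r * Real.cos (φ - θ) ∧
      across θ (r * Real.cos φ, r * Real.sin φ) = r * Real.sin (φ - θ) := by
    intro r φ
    simp only [along, across, Real.cos_sub, Real.sin_sub]
    constructor <;> ring
  have habs : ∀ r δ : ℝ, 0 ≤ r → |δ| ≤ Real.pi →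
      r * Real.cos δ * Real.sin (α 0) - |r * Real.sin δ| * Real.cos (α 0) =
        r * Real.sin (α 0 - |δ|) := by
    intro r δ hr0 hδ
    rw [abs_mul, abs_of_nonneg hr0, Real.abs_sin_eq_sin_abs_of_abs_le_pi hδ, Real.sin_sub,
      Real.cos_abs]
    ring
  constructor
  · rintro ⟨r, φ, hr0, hφ, rfl⟩
    rw [(hpolar r φ).1, (hpolar r φ).2, key, habs r _ hr0 (hφ.trans hr.2.le)]
    refine mul_nonneg hr0 (Real.sin_nonneg_of_nonneg_of_le_pi (by linarith) ?_)
    linarith [abs_nonneg (φ - θ), hr.2]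
  · intro h
    set z : ℂ := ⟨along θ q, across θ q⟩
    have hz1 : ‖z‖ * Real.cos z.arg = along θ q := Complex.norm_mul_cos_arg z
    have hz2 : ‖z‖ * Real.sin z.arg = across θ q := Complex.norm_mul_sin_arg z
    have hq : q = (‖z‖ * Real.cos (θ + z.arg), ‖z‖ * Real.sin (θ + z.arg)) := by
      have := hpolar ‖z‖ (θ + z.arg)
      rw [add_sub_cancel_left, hz1, hz2] at this
      exact ext_along_across this.1.symm this.2.symm
    rcases (norm_nonneg z).eq_or_lt with h0 | h0
    · refine ⟨0, θ, le_rfl, by simpa using hr.1.le, ?_⟩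
      rw [hq, ← h0]; simp
    · refine ⟨‖z‖, θ + z.arg, h0.le, ?_, hq⟩
      rw [← hz1, ← hz2, key, habs _ _ h0.le (Complex.abs_arg_le_pi z)] at h
      rw [add_sub_cancel_left]
      by_contra! hlt
      have := Real.sin_neg_of_neg_of_neg_pi_lt (x := α 0 - |z.arg|) (by linarith)
        (by linarith [Complex.abs_arg_le_pi z, hr.1])
      nlinarith

theorem mul_mem_ray (s r φ : ℝ) :
    mul (s * Real.cos θ, s * Real.sin θ, 0) (r * Real.cos φ, r * Real.sin φ, 0) =
      (s * Real.cos θ + r * Real.cos φ, s * Real.sin θ + r * Real.sin φ,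
        -(s * (r * Real.sin (φ - θ)))) := by
  simp only [mul, Real.sin_sub]
  refine Prod.ext rfl (Prod.ext rfl ?_)
  ring

theorem along_ray (s r φ : ℝ) : along θ (s * Real.cos θ + r * Real.cos φ,
    s * Real.sin θ + r * Real.sin φ) = s + r * Real.cos (φ - θ) := by
  simp only [along, Real.cos_sub]
  linear_combination s * Real.sin_sq_add_cos_sq θ

theorem across_ray (s r φ : ℝ) : across θ (s * Real.cos θ + r * Real.cos φ,
    s * Real.sin θ + r * Real.sin φ) = r * Real.sin (φ - θ) := by
  simp only [across, Real.sin_sub]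
  ring

/-- The sign `ε` selects the upper or the lower ruling; on both the height is `-s` times the
transverse coordinate. -/
theorem mem_ruledSurface_iff (p : Point) :
    p ∈ ruledSurface θ α ↔ ∃ s r ε : ℝ, 0 ≤ s ∧ 0 ≤ r ∧ (ε = 1 ∨ ε = -1) ∧
      along θ (proj p) = s + r * Real.cos (α s) ∧ across θ (proj p) = ε * (r * Real.sin (α s)) ∧
      p.2.2 = -(s * across θ (proj p)) := by
  have hray : ∀ s φ : ℝ, p ∈ horizontalRay (s * Real.cos θ, s * Real.sin θ, 0) φ ↔
      ∃ r, 0 ≤ r ∧ along θ (proj p) = s + r * Real.cos (φ - θ) ∧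
        across θ (proj p) = r * Real.sin (φ - θ) ∧ p.2.2 = -(s * across θ (proj p)) := by
    intro s φ
    simp only [horizontalRay, mem_ofPred_eq, mul_mem_ray]
    refine exists_congr fun r => and_congr_right fun _ => ⟨?_, ?_⟩
    · rintro rfl
      exact ⟨along_ray s r φ, across_ray s r φ, by
        dsimp only [proj]; rw [across_ray]⟩
    · rintro ⟨h1, h2, h3⟩
      have h4 : proj p = (s * Real.cos θ + r * Real.cos φ, s * Real.sin θ + r * Real.sin φ) :=
        ext_along_across (θ := θ) (by rw [h1, along_ray]) (by rw [h2, across_ray])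
      rw [h2] at h3
      obtain ⟨h5, h6⟩ := Prod.ext_iff.1 h4
      exact Prod.ext h5 (Prod.ext h6 h3)
  simp only [ruledSurface, mem_iUnion, mem_union, hray, mem_Ici, exists_prop]
  constructor
  · rintro ⟨s, hs, ⟨r, hr, h1, h2, h3⟩ | ⟨r, hr, h1, h2, h3⟩⟩
    · exact ⟨s, r, 1, hs, hr, Or.inl rfl, by simpa using h1, by simpa using h2, h3⟩
    · refine ⟨s, r, -1, hs, hr, Or.inr rfl, by simpa using h1, ?_, h3⟩
      rw [h2, show θ - α s - θ = -α s by ring, Real.sin_neg]; ring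
  · rintro ⟨s, r, ε, hs, hr, rfl | rfl, h1, h2, h3⟩
    · exact ⟨s, hs, Or.inl ⟨r, hr, by simpa using h1, by simpa using h2, h3⟩⟩
    · refine ⟨s, hs, Or.inr ⟨r, hr, by simpa using h1, ?_, h3⟩⟩
      rw [h2, show θ - α s - θ = -α s by ring, Real.sin_neg]; ring

theorem patchedSurface_eq_graph (hα : IsAngleFunction α) :
    patchedSurface θ α = graph (ruledHeight θ α) := by
  ext p
  simp only [patchedSurface, mem_union, mem_ruledSurface_iff, mem_ofPred_eq, graph,
    mem_wedge_iff hα, not_le]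
  constructor
  · rintro (⟨s, r, ε, hs, hr, hε, h1, h2, h3⟩ | ⟨h1, h2⟩)
    · have hsin := hα.sin_pos hs
      have hw : |across θ (proj p)| = r * Real.sin (α s) := by
        rw [h2, abs_mul, show |ε| = 1 by rcases hε with rfl | rfl <;> simp, one_mul,
          abs_of_nonneg (mul_nonneg hr hsin.le)]
      have heq : s + |across θ (proj p)| * Real.cot (α s) = along θ (proj p) := by
        rw [hw, h1, Real.cot_eq_cos_div_sin]; field_simp
      rw [ruledHeight, foot_eq hα ⟨hs, heq.ge, fun _ => heq⟩, h3]; ring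
    · rw [h1, ruledHeight, foot_eq_zero hα h2.le]; simp
  · intro h
    rcases lt_or_ge (along θ (proj p)) (|across θ (proj p)| * Real.cot (α 0)) with hlt | hge
    · right
      rw [h, ruledHeight, foot_eq_zero hα hlt.le]
      exact ⟨by simp, hlt⟩
    · left
      have hf := isFoot_foot hα (θ := θ) (proj p)
      set s := foot θ α (proj p)
      have hsin := hα.sin_pos hf.nonneg
      have heq : s + |across θ (proj p)| * Real.cot (α s) = along θ (proj p) := by
        rcases hf.nonneg.eq_or_lt with h0 | h0
        · have := hf.le
          rw [← h0] at this ⊢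
          linarith
        · exact hf.eq h0
      have hcos : |across θ (proj p)| / Real.sin (α s) * Real.cos (α s) =
          |across θ (proj p)| * Real.cot (α s) := by
        rw [Real.cot_eq_cos_div_sin]; ring
      have hmul : |across θ (proj p)| / Real.sin (α s) * Real.sin (α s) = |across θ (proj p)| :=
        div_mul_cancel₀ _ hsin.ne'
      have ht : p.2.2 = -(s * across θ (proj p)) := by rw [h, ruledHeight]; ring
      rcases abs_choice (across θ (proj p)) with hc | hc
      · exact ⟨s, |across θ (proj p)| / Real.sin (α s), 1, hf.nonneg, by positivity, Or.inl rfl,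
          by rw [hcos, heq], by rw [hmul, hc, one_mul], ht⟩
      · exact ⟨s, |across θ (proj p)| / Real.sin (α s), -1, hf.nonneg, by positivity, Or.inr rfl,
          by rw [hcos, heq], by rw [hmul, hc]; ring, ht⟩

/-! ### The singular set -/

theorem along_add_smul (q v : ℝ × ℝ) (t : ℝ) :
    along θ (q + t • v) = along θ q + t * along θ v := by
  simp only [along, Prod.fst_add, Prod.snd_add, Prod.smul_fst, Prod.smul_snd, smul_eq_mul]; ring

theorem across_add_smul (q v : ℝ × ℝ) (t : ℝ) :
    across θ (q + t • v) = across θ q + t * across θ v := by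
  simp only [across, Prod.fst_add, Prod.snd_add, Prod.smul_fst, Prod.smul_snd, smul_eq_mul]; ring

theorem along_direction (θ : ℝ) : along θ (Real.cos θ, Real.sin θ) = 1 := by
  simp only [along]; linear_combination Real.sin_sq_add_cos_sq θ

theorem across_direction (θ : ℝ) : across θ (Real.cos θ, Real.sin θ) = 0 := by
  simp only [across]; ring

/-- Along the direction `θ`, the graph rises towards the halfline from neither side. -/
theorem across_mul_fderiv_nonpos (hα : IsAngleFunction α) {q : ℝ × ℝ} {D : ℝ × ℝ →L[ℝ] ℝ}
    (hD : HasFDerivAt (ruledHeight θ α) D q) :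
    across θ q * D (Real.cos θ, Real.sin θ) ≤ 0 := by
  have h1 : HasDerivAt (fun t : ℝ => ruledHeight θ α (q + t • (Real.cos θ, Real.sin θ)))
      (D (Real.cos θ, Real.sin θ)) 0 := hD.hasLineDerivAt _
  -- With `y` fixed, `y u = -y² s` is nonincreasing, since the foot moves forward with `x`.
  refine (h1.const_mul (across θ q)).nonpos_of_antitone fun s t hst => ?_
  have ha : ∀ t : ℝ, across θ (q + t • (Real.cos θ, Real.sin θ)) = across θ q := fun t => by
    rw [across_add_smul, across_direction, mul_zero, add_zero]
  have h2 := isFoot_foot hα (θ := θ) (q + s • (Real.cos θ, Real.sin θ))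
  have h3 := isFoot_foot hα (θ := θ) (q + t • (Real.cos θ, Real.sin θ))
  rw [ha, along_add_smul, along_direction, mul_one] at h2 h3
  have h4 := h2.mono hα.monotoneOn_cot h3 (abs_nonneg _) (by linarith)
  simp only [ruledHeight, ha]
  nlinarith [sq_nonneg (across θ q)]

open Topology Asymptotics in
theorem singularSet_ruledHeight (hα : IsAngleFunction α) :
    singularSet (ruledHeight θ α) = planarRay θ := by
  ext q
  simp only [singularSet, planarRay, mem_ofPred_eq]
  constructor
  · intro hq
    by_cases hy : across θ q = 0
    · rcases le_or_gt 0 (along θ q) with hx | hx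
      · refine ⟨along θ q, hx, ?_⟩
        exact Prod.ext (by rw [fst_eq θ q, hy]; simp) (by rw [snd_eq θ q, hy]; simp)
      · exfalso
        -- Behind the vertex the graph is locally the plane `t = 0`, which is horizontal only over
        -- the origin.
        have hev : ruledHeight θ α =ᶠ[𝓝 q] fun _ => 0 := by
          have ho : IsOpen {z : ℝ × ℝ | along θ z < |across θ z| * Real.cot (α 0)} :=
            isOpen_lt (by unfold along; fun_prop) (by unfold across; fun_prop)
          filter_upwards [ho.mem_nhds (show q ∈ _ by simpa [hy] using hx)] with z hz
          rw [ruledHeight, foot_eq_zero hα (le_of_lt hz), mul_zero, neg_zero]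
        have h0 := hq.unique ((hasFDerivAt_const (0 : ℝ) q).congr_of_eventuallyEq hev)
        have h1 := DFunLike.congr_fun h0 (1, 0)
        have h2 := DFunLike.congr_fun h0 (0, 1)
        simp at h1 h2
        simp [along, h1, h2] at hx
    · exfalso
      have h1 := across_mul_fderiv_nonpos hα hq
      have h2 : (q.2 • ContinuousLinearMap.fst ℝ ℝ ℝ - q.1 • ContinuousLinearMap.snd ℝ ℝ ℝ)
          (Real.cos θ, Real.sin θ) = across θ q := by
        simp [across]
      rw [h2] at h1
      exact hy (mul_self_eq_zero.1 (le_antisymm h1 (mul_self_nonneg _)))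
  · rintro ⟨s, hs, rfl⟩
    set q : ℝ × ℝ := (s * Real.cos θ, s * Real.sin θ) with hq
    set D := q.2 • ContinuousLinearMap.fst ℝ ℝ ℝ - q.1 • ContinuousLinearMap.snd ℝ ℝ ℝ with hD
    have hqa : along θ q = s := by
      simp only [along, hq]; linear_combination s * Real.sin_sq_add_cos_sq θ
    have hqc : across θ q = 0 := by simp only [across, hq]; ring
    have hf : foot θ α q = s :=
      foot_eq hα ⟨hs, by simp [hqa, hqc], fun _ => by simp [hqa, hqc]⟩
    obtain ⟨T, C, -, hC, -, hfC⟩ := foot_bounds (θ := θ) hα (‖q‖ + 1)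
    have hmem : q ∈ Metric.ball (0 : ℝ × ℝ) (‖q‖ + 1) := mem_ball_zero_iff.2 (lt_add_one _)
    -- The difference is a product of two Lipschitz functions vanishing at `q`, hence quadratically
    -- small.
    have hO : (fun z => ruledHeight θ α z - D z) =O[𝓝 q] fun z => ‖z - q‖ ^ 2 := by
      refine IsBigO.of_bound (2 * C) ?_
      filter_upwards [Metric.isOpen_ball.mem_nhds hmem] with z hz
      have h1 : ruledHeight θ α z - D z = -(across θ (z - q) * (foot θ α z - foot θ α q)) := by
        rw [across_sub, hqc, hf]
        simp only [ruledHeight, hD, hq, across, sub_apply, smul_apply, ContinuousLinearMap.coe_fst',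
          ContinuousLinearMap.coe_snd', smul_eq_mul]
        ring
      rw [h1, norm_neg, norm_mul, Real.norm_eq_abs, Real.norm_eq_abs, norm_pow, norm_norm]
      have h2 := hfC z hz q hmem
      rw [dist_eq_norm] at h2
      refine (mul_le_mul (abs_across_le θ (z - q)) h2 (abs_nonneg _) (by positivity)).trans ?_
      exact le_of_eq (by ring)
    have h2 := (hO.hasFDerivAt (𝕜 := ℝ) one_lt_two).add D.hasFDerivAt
    rw [zero_add] at h2
    exact h2.congr_of_eventuallyEq (.of_forall fun z => by simp)

/-! ### The eikonal potential -/

theorem sqrt_mul_sqrt_ge (a b c d : ℝ) :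
    a * c + b * d ≤ √(a ^ 2 + b ^ 2) * √(c ^ 2 + d ^ 2) := by
  rw [← Real.sqrt_mul (by positivity)]
  exact Real.le_sqrt_of_sq_le (by nlinarith [sq_nonneg (a * d - b * c)])

theorem sqrt_triangle (a b c d : ℝ) :
    √((a + c) ^ 2 + (b + d) ^ 2) ≤ √(a ^ 2 + b ^ 2) + √(c ^ 2 + d ^ 2) := by
  refine Real.sqrt_le_iff.2 ⟨by positivity, ?_⟩
  have h1 := Real.sq_sqrt (show 0 ≤ a ^ 2 + b ^ 2 by positivity)
  have h2 := Real.sq_sqrt (show 0 ≤ c ^ 2 + d ^ 2 by positivity)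
  nlinarith [sqrt_mul_sqrt_ge a b c d]

/-- The distance from `q` to the point at distance `s` on the halfline of direction `θ`. -/
noncomputable def rayDist (θ s : ℝ) (q : ℝ × ℝ) : ℝ :=
  √((q.1 - s * Real.cos θ) ^ 2 + (q.2 - s * Real.sin θ) ^ 2)

theorem rayDist_eq (θ s : ℝ) (q : ℝ × ℝ) :
    rayDist θ s q = √((along θ q - s) ^ 2 + across θ q ^ 2) := by
  unfold rayDist along across
  congr 1
  linear_combination (s ^ 2 - q.1 ^ 2 - q.2 ^ 2) * Real.sin_sq_add_cos_sq θ

/-- The potential of the calibration: an eikonal function whose gradient lines are the rulings. -/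
noncomputable def potential (θ : ℝ) (α : ℝ → ℝ) (q : ℝ × ℝ) : ℝ :=
  rayDist θ (foot θ α q) q + ∫ τ in (0 : ℝ)..foot θ α q, Real.cos (α τ)

/-- The primitive of the nondecreasing function `cos ∘ α` is convex, so it lies above its tangent
line at `s`. -/
theorem mul_cos_le_integral (hα : IsAngleFunction α) {s t : ℝ} (hs : 0 ≤ s) (ht : 0 ≤ t) :
    (t - s) * Real.cos (α s) ≤
      (∫ τ in (0 : ℝ)..t, Real.cos (α τ)) - ∫ τ in (0 : ℝ)..s, Real.cos (α τ) := by
  have hint : ∀ a b : ℝ, 0 ≤ a → 0 ≤ b →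
      IntervalIntegrable (fun τ => Real.cos (α τ)) volume a b := fun a b ha hb =>
    (hα.continuousOn_cos.mono fun x hx => (le_min ha hb).trans hx.1).intervalIntegrable
  rw [intervalIntegral.integral_interval_sub_left (hint 0 t le_rfl ht) (hint 0 s le_rfl hs)]
  rcases le_total s t with h | h
  · have := intervalIntegral.integral_mono_on h (intervalIntegrable_const (c := Real.cos (α s)))
      (hint s t hs ht) fun x hx => hα.monotoneOn_cos hs (hs.trans hx.1) hx.1
    rwa [intervalIntegral.integral_const, smul_eq_mul] at this
  · have := intervalIntegral.integral_mono_on h (hint t s ht hs)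
      (intervalIntegrable_const (c := Real.cos (α s))) fun x hx =>
        hα.monotoneOn_cos (ht.trans hx.1) hs hx.2
    rw [intervalIntegral.integral_const, smul_eq_mul] at this
    rw [intervalIntegral.integral_symm]
    linarith

/-- The first-order optimality of the foot: the direction from `s` to the point has cosine `cos
α(s)` if `s > 0`, which gives equality. At the endpoint `s = 0` its cosine is at most `cos α(0)`,
and `t - s ≥ 0`. -/
theorem IsFoot.mul_le (hα : IsAngleFunction α) {x w s t : ℝ}
    (h : IsFoot (fun s => Real.cot (α s)) x w s) (hw : 0 ≤ w) (ht : 0 ≤ t) :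
    (t - s) * (x - s) ≤ (t - s) * (Real.cos (α s) * √((x - s) ^ 2 + w ^ 2)) := by
  have hm := hα.sin_pos h.nonneg
  have hkm := Real.sin_sq_add_cos_sq (α s)
  set k := Real.cos (α s) with hk
  set m := Real.sin (α s)
  set N := √((x - s) ^ 2 + w ^ 2)
  have hN : 0 ≤ N := Real.sqrt_nonneg _
  have hN2 : N ^ 2 = (x - s) ^ 2 + w ^ 2 := Real.sq_sqrt (by positivity)
  have hcot : Real.cot (α s) = k / m := Real.cot_eq_cos_div_sin _
  rcases h.nonneg.eq_or_lt with h0 | h0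
  · have h1 : (x - s) * m ≤ w * k := by
      have := h.le
      simp only [hcot] at this
      rw [← sub_le_iff_le_add', mul_div_assoc', le_div_iff₀ hm] at this
      exact this
    refine mul_le_mul_of_nonneg_left ?_ (by linarith)
    rcases le_or_gt (x - s) 0 with hA | hA
    · rcases le_or_gt 0 k with hk0 | hk0
      · exact hA.trans (mul_nonneg hk0 hN)
      · have h2 : (w * k) ^ 2 ≤ ((x - s) * m) ^ 2 := by
          have h0 := mul_nonpos_of_nonneg_of_nonpos hw hk0.le
          nlinarith [mul_nonneg (sub_nonneg.2 h1) (show 0 ≤ -((x - s) * m + w * k) by linarith)]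
        have h3 : (-k * N) ^ 2 ≤ (-(x - s)) ^ 2 := by nlinarith
        linarith [le_of_abs_le (abs_le_of_sq_le_sq h3 (by linarith))]
    · have hk0 : 0 ≤ k := by
        by_contra! hk0
        nlinarith [mul_pos hA hm]
      have h2 : ((x - s) * m) ^ 2 ≤ (w * k) ^ 2 :=
        pow_le_pow_left₀ (by positivity) h1 2
      have h3 : (x - s) ^ 2 ≤ (k * N) ^ 2 := by nlinarith
      exact le_of_abs_le (abs_le_of_sq_le_sq h3 (by positivity))
  · have h1 : x - s = w * k / m := by
      have := h.eq h0
      simp only [hcot] at this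
      rw [← this]; ring
    have h2 : N = w / m := by
      rw [← sq_eq_sq₀ hN (by positivity), hN2, h1]
      field_simp
      linear_combination w ^ 2 * hkm
    rw [h1, h2]
    exact le_of_eq (by ring)

/-- With `N`, `N'` the distances to the points at `s` and `t`, Cauchy–Schwarz and optimality give `N
N' ≥ N² - (t - s)(x - s) ≥ N² - (t - s) N cos α(s)`. Division by `N` and convexity of the integral
finish; `N = 0` is treated apart. -/
theorem potential_le (hα : IsAngleFunction α) (q : ℝ × ℝ) {t : ℝ} (ht : 0 ≤ t) :
    potential θ α q ≤ rayDist θ t q + ∫ τ in (0 : ℝ)..t, Real.cos (α τ) := by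
  have hf := isFoot_foot hα (θ := θ) q
  have h1 := mul_cos_le_integral hα hf.nonneg ht
  have h2 := hf.mul_le hα (abs_nonneg _) ht
  unfold potential
  rw [rayDist_eq, rayDist_eq]
  rw [sq_abs] at h2
  set s := foot θ α q
  set N := √((along θ q - s) ^ 2 + across θ q ^ 2)
  set N' := √((along θ q - t) ^ 2 + across θ q ^ 2)
  have hN : 0 ≤ N := Real.sqrt_nonneg _
  have hN2 : N ^ 2 = (along θ q - s) ^ 2 + across θ q ^ 2 := Real.sq_sqrt (by positivity)
  have h3 : (along θ q - s) * (along θ q - t) + across θ q * across θ q ≤ N * N' :=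
    sqrt_mul_sqrt_ge _ _ _ _
  suffices h : N - (t - s) * Real.cos (α s) ≤ N' by linarith
  rcases hN.eq_or_lt with h0 | h0
  · have h4 : along θ q - s = 0 := by
      rw [← h0] at hN2
      nlinarith [sq_nonneg (along θ q - s), sq_nonneg (across θ q)]
    have h5 : |along θ q - t| ≤ N' :=
      Real.abs_le_sqrt (by nlinarith [sq_nonneg (across θ q)])
    rw [sub_eq_zero.1 h4, abs_sub_comm] at h5
    rw [← h0]
    have h6 : |(t - s) * Real.cos (α s)| ≤ |t - s| := by
      rw [abs_mul]
      exact mul_le_of_le_one_right (abs_nonneg _) (Real.abs_cos_le_one _)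
    linarith [neg_abs_le ((t - s) * Real.cos (α s))]
  · refine le_of_mul_le_mul_left ?_ h0
    nlinarith

/-- A minimum of translated distance functions is `1`-Lipschitz: use the foot of `q` as a competitor
at `p`. -/
theorem potential_euclidean_lipschitz (hα : IsAngleFunction α) (p q : ℝ × ℝ) :
    |potential θ α p - potential θ α q| ≤ √((p.1 - q.1) ^ 2 + (p.2 - q.2) ^ 2) := by
  have key : ∀ p q : ℝ × ℝ, potential θ α p - potential θ α q ≤
      √((p.1 - q.1) ^ 2 + (p.2 - q.2) ^ 2) := by
    intro p q
    have h1 := potential_le hα (θ := θ) p (isFoot_foot hα (θ := θ) q).nonneg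
    have h2 : rayDist θ (foot θ α q) p ≤
        √((p.1 - q.1) ^ 2 + (p.2 - q.2) ^ 2) + rayDist θ (foot θ α q) q := by
      have := sqrt_triangle (p.1 - q.1) (p.2 - q.2) (q.1 - foot θ α q * Real.cos θ)
        (q.2 - foot θ α q * Real.sin θ)
      unfold rayDist
      simpa only [sub_add_sub_cancel] using this
    have h3 : potential θ α q =
        rayDist θ (foot θ α q) q + ∫ τ in (0 : ℝ)..foot θ α q, Real.cos (α τ) := rfl
    linarith
  refine abs_sub_le_iff.2 ⟨key p q, ?_⟩
  have := key q p
  rwa [← neg_sub p.1, ← neg_sub p.2, neg_sq, neg_sq] at this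

/-- The envelope argument: with the foot frozen, `potential` minus `rayDist` is maximal at `q`, so
the two derivatives agree. -/
theorem fderiv_potential (hα : IsAngleFunction α) {q : ℝ × ℝ}
    (hd : DifferentiableAt ℝ (potential θ α) q) (hN : 0 < rayDist θ (foot θ α q) q) (v : ℝ × ℝ) :
    fderiv ℝ (potential θ α) q v = ((q.1 - foot θ α q * Real.cos θ) * v.1 +
      (q.2 - foot θ α q * Real.sin θ) * v.2) / rayDist θ (foot θ α q) q := by
  set s := foot θ α q with hs
  have h1 : HasDerivAt (fun t : ℝ => potential θ α (q + t • v)) (fderiv ℝ (potential θ α) q v) 0 :=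
    hd.hasFDerivAt.hasLineDerivAt v
  have hpos : 0 < (q.1 - s * Real.cos θ) ^ 2 + (q.2 - s * Real.sin θ) ^ 2 := Real.sqrt_pos.1 hN
  have h2 : HasDerivAt (fun t : ℝ => rayDist θ s (q + t • v))
      (((q.1 - s * Real.cos θ) * v.1 + (q.2 - s * Real.sin θ) * v.2) / rayDist θ s q) 0 := by
    have ha : ∀ a b : ℝ, HasDerivAt (fun t : ℝ => (a + t * b) ^ 2) (2 * (a * b)) 0 := by
      intro a b
      have := (((hasDerivAt_id (0 : ℝ)).mul_const b).const_add a).pow 2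
      exact this.congr_deriv (by simp; ring)
    have hb := ((ha (q.1 - s * Real.cos θ) v.1).add (ha (q.2 - s * Real.sin θ) v.2)).sqrt
      (by simpa using hpos.ne')
    convert hb using 1
    · ext t
      simp only [rayDist, Prod.fst_add, Prod.snd_add, Prod.smul_fst, Prod.smul_snd, smul_eq_mul,
        Pi.add_apply]
      congr 2 <;> ring
    · simp only [rayDist, Pi.add_apply, zero_mul, add_zero]
      rw [← mul_add, mul_div_mul_left _ _ two_ne_zero]
  have hmax : IsLocalMax
      (fun t : ℝ => potential θ α (q + t • v) - rayDist θ s (q + t • v)) 0 := by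
    refine .of_forall fun t => ?_
    have h3 := potential_le hα (θ := θ) (q + t • v) (isFoot_foot hα (θ := θ) q).nonneg
    have h4 : potential θ α q = rayDist θ s q + ∫ τ in (0 : ℝ)..s, Real.cos (α τ) := rfl
    simp only [zero_smul, add_zero]
    linarith
  have := hmax.hasDerivAt_eq_zero (h1.sub h2)
  linarith

/-! ### The calibration inequality -/

/-- Along a ruling the foot is constant, so the height is linear in the transverse coordinate. -/
theorem fderiv_ruledHeight_ruling (hα : IsAngleFunction α) {q : ℝ × ℝ}
    (hd : DifferentiableAt ℝ (ruledHeight θ α) q) :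
    fderiv ℝ (ruledHeight θ α) q
      (q.1 - foot θ α q * Real.cos θ, q.2 - foot θ α q * Real.sin θ) =
      -(across θ q * foot θ α q) := by
  have hf := isFoot_foot hα (θ := θ) q
  set s := foot θ α q with hs
  set e : ℝ × ℝ := (q.1 - s * Real.cos θ, q.2 - s * Real.sin θ) with he
  have hea : along θ e = along θ q - s := by
    simp only [along, he]; linear_combination -s * Real.sin_sq_add_cos_sq θ
  have hec : across θ e = across θ q := by simp only [across, he]; ring
  have h1 : HasDerivAt (fun t : ℝ => ruledHeight θ α (q + t • e))
      (fderiv ℝ (ruledHeight θ α) q e) 0 := hd.hasFDerivAt.hasLineDerivAt e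
  have h2 : HasDerivAt (fun t : ℝ => -((1 + t) * (across θ q * s))) (-(across θ q * s)) 0 := by
    have := (((hasDerivAt_id (0 : ℝ)).const_add 1).mul_const (across θ q * s)).neg
    rw [one_mul] at this
    exact this
  refine h1.unique (h2.congr_of_eventuallyEq ?_)
  filter_upwards [lt_mem_nhds (show (-1 : ℝ) < 0 by norm_num)] with t ht
  have ht' : 0 < 1 + t := by linarith
  have h3 := hf.ray ht'
  have h4 : foot θ α (q + t • e) = s := by
    refine foot_eq hα ?_
    rw [along_add_smul, across_add_smul, hea, hec]
    convert h3 using 1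
    · ring
    · rw [← abs_of_pos ht', ← abs_mul]; congr 1; ring
  rw [ruledHeight, h4, across_add_smul, hec]; ring

theorem calibration_ruledHeight (hα : IsAngleFunction α) {q : ℝ × ℝ} (hy : across θ q ≠ 0)
    (hu : DifferentiableAt ℝ (ruledHeight θ α) q) (hψ : DifferentiableAt ℝ (potential θ α) q)
    {a b : ℝ} (hab : a ^ 2 + b ^ 2 ≤ 1) :
    conormal (ruledHeight θ α) q (a, b) ≤ conormal (ruledHeight θ α) q
      (fderiv ℝ (potential θ α) q (0, 1), -fderiv ℝ (potential θ α) q (1, 0)) := by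
  have hN : 0 < rayDist θ (foot θ α q) q := by
    rw [rayDist_eq]
    exact Real.sqrt_pos.2 (by positivity)
  rw [fderiv_potential hα hψ hN, fderiv_potential hα hψ hN]
  have hr := fderiv_ruledHeight_ruling hα hu
  have hd := across_mul_fderiv_nonpos hα hu.hasFDerivAt
  have hN2 : rayDist θ (foot θ α q) q ^ 2 = (q.1 - foot θ α q * Real.cos θ) ^ 2 +
      (q.2 - foot θ α q * Real.sin θ) ^ 2 := Real.sq_sqrt (by positivity)
  set s := foot θ α q
  set N := rayDist θ s q
  set e1 := q.1 - s * Real.cos θ with he1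
  set e2 := q.2 - s * Real.sin θ with he2
  -- The ruling is horizontal and lies in the graph, so the conormal is `l` times the rotated ruling
  -- direction `(e2, -e1)`.
  have hperp : conormal (ruledHeight θ α) q (e1, e2) = 0 := by
    simp only [conormal, hr]
    simp only [he1, he2, across]; ring
  have hdir : 0 ≤ across θ q *
      conormal (ruledHeight θ α) q (Real.cos θ, Real.sin θ) := by
    have : conormal (ruledHeight θ α) q (Real.cos θ, Real.sin θ) = across θ q -
        fderiv ℝ (ruledHeight θ α) q (Real.cos θ, Real.sin θ) := by
      simp only [conormal, across]
    rw [this]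
    nlinarith [sq_nonneg (across θ q)]
  rw [conormal_eq] at hperp hdir
  rw [conormal_eq _ _ a, conormal_eq _ _ (_ / _)]
  set n1 := conormal (ruledHeight θ α) q (1, 0)
  set n2 := conormal (ruledHeight θ α) q (0, 1)
  set l := (e2 * n1 - e1 * n2) / N ^ 2 with hl
  have hNne : N ^ 2 ≠ 0 := by positivity
  have hn1 : n1 = l * e2 := by
    rw [hl, div_mul_eq_mul_div, eq_div_iff hNne, hN2]
    linear_combination e1 * hperp
  have hn2 : n2 = -(l * e1) := by
    rw [hl, div_mul_eq_mul_div, ← neg_div, eq_div_iff hNne, hN2]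
    linear_combination e2 * hperp
  have hy' : across θ q = e2 * Real.cos θ - e1 * Real.sin θ := by
    simp only [across, he1, he2]; ring
  -- Pairing with the direction of `L` gives `y² l = y² - y ∂ₓu ≥ 0`.
  have hl0 : 0 ≤ l := by
    have h1 : across θ q * (Real.cos θ * n1 + Real.sin θ * n2) = across θ q ^ 2 * l := by
      rw [hn1, hn2, hy']; ring
    rw [h1] at hdir
    exact nonneg_of_mul_nonneg_right hdir (by positivity)
  have hcs : a * e2 - b * e1 ≤ N := by
    refine le_of_abs_le (abs_le_of_sq_le_sq ?_ hN.le)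
    nlinarith [sq_nonneg (a * e1 + b * e2), sq_nonneg e1, sq_nonneg e2]
  have hR : (e1 * (0, 1).1 + e2 * (0, 1).2) / N * n1 +
      -((e1 * (1, 0).1 + e2 * (1, 0).2) / N) * n2 = l * N := by
    rw [hn1, hn2]
    field_simp
    linear_combination -l * hN2
  rw [hR, hn1, hn2]
  nlinarith [mul_le_mul_of_nonneg_left hcs hl0]

theorem ae_across_ne_zero (θ : ℝ) : ∀ᵐ q : ℝ × ℝ, across θ q ≠ 0 := by
  let f : ℝ × ℝ →ₗ[ℝ] ℝ := Real.cos θ • LinearMap.snd ℝ ℝ ℝ - Real.sin θ • LinearMap.fst ℝ ℝ ℝ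
  have hf : ∀ q, f q = across θ q := fun q => by simp [f, across, mul_comm]
  have hne : LinearMap.ker f ≠ ⊤ := by
    intro h
    have h1 : f (-Real.sin θ, Real.cos θ) = 0 := by
      rw [← LinearMap.mem_ker, h]; trivial
    rw [hf, across] at h1
    nlinarith [Real.sin_sq_add_cos_sq θ]
  have h0 := Measure.addHaar_submodule (volume : Measure (ℝ × ℝ)) _ hne
  rw [ae_iff]
  convert h0 using 2
  ext q
  simp [hf]

theorem isAreaMinimizing_subgraph_ruledHeight (hα : IsAngleFunction α) :
    IsAreaMinimizing (subgraph (ruledHeight θ α)) := by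
  refine isAreaMinimizing_of_calibration (ψ := potential θ α) (locallyLipschitz_ruledHeight hα)
    (potential_euclidean_lipschitz hα) ?_
  have hu : ∀ᵐ q, DifferentiableAt ℝ (ruledHeight θ α) q := by
    have h : ∀ n : ℕ, ∀ᵐ q, q ∈ Metric.ball (0 : ℝ × ℝ) n →
        DifferentiableAt ℝ (ruledHeight θ α) q := by
      intro n
      obtain ⟨C, hC⟩ := ((locallyLipschitz_ruledHeight hα (θ := θ)).locallyLipschitzOn
        (s := Metric.closedBall 0 (n : ℝ))).exists_lipschitzOnWith_of_compact
          (isCompact_closedBall 0 (n : ℝ))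
      filter_upwards [(hC.mono Metric.ball_subset_closedBall).ae_differentiableWithinAt_of_mem
        (μ := volume)] with q hq hqn
      exact (hq hqn).differentiableAt (Metric.isOpen_ball.mem_nhds hqn)
    filter_upwards [ae_all_iff.2 h] with q hq
    obtain ⟨n, hn⟩ := exists_nat_gt ‖q‖
    exact hq n (mem_ball_zero_iff.2 hn)
  filter_upwards [ae_across_ne_zero θ, hu, (lipschitzWith_of_euclidean_lipschitz
    (potential_euclidean_lipschitz (θ := θ) hα)).ae_differentiableAt] with q h1 h2 h3 a b hab
  exact calibration_ruledHeight hα h1 h2 h3 hab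

end Height

/-! ### Regularity of the cone piece -/

theorem hasDerivAt_mul_abs (y : ℝ) : HasDerivAt (fun y : ℝ => y * |y|) (2 * |y|) y := by
  rcases eq_or_ne y 0 with rfl | hy
  · rw [hasDerivAt_iff_isLittleO_nhds_zero]
    simp only [zero_add, abs_zero, mul_zero, smul_zero, sub_zero]
    have h : (fun h : ℝ => |h|) =o[nhds 0] fun _ => (1 : ℝ) :=
      (Asymptotics.isLittleO_one_iff ℝ).2 (by simpa using continuous_abs.tendsto (0 : ℝ))
    simpa using (Asymptotics.isBigO_refl (fun h : ℝ => h) (nhds 0)).mul_isLittleO h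
  · refine ((hasDerivAt_id y).mul (hasDerivAt_abs hy)).congr_deriv ?_
    rw [id, one_mul, mul_comm y, sign_mul_self]; ring

/-- The derivative of `conePiece b`. -/
noncomputable def conePieceDeriv (b : ℝ) (q : ℝ × ℝ) : ℝ × ℝ →L[ℝ] ℝ :=
  (-q.2) • ContinuousLinearMap.fst ℝ ℝ ℝ + (2 * b * |q.2| - q.1) • ContinuousLinearMap.snd ℝ ℝ ℝ

theorem hasFDerivAt_conePiece (b : ℝ) (q : ℝ × ℝ) :
    HasFDerivAt (conePiece b) (conePieceDeriv b q) q := by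
  have h1 : HasFDerivAt (fun q : ℝ × ℝ => q.2 * |q.2|)
      ((2 * |q.2|) • ContinuousLinearMap.snd ℝ ℝ ℝ) q :=
    (hasDerivAt_mul_abs q.2).comp_hasFDerivAt q hasFDerivAt_snd
  have h2 := ((hasFDerivAt_fst (𝕜 := ℝ) (p := q)).mul hasFDerivAt_snd).neg.add (h1.const_mul b)
  refine HasFDerivAt.congr_fderiv h2 ?_
  ext
  · simp [conePieceDeriv]
  · simp [conePieceDeriv]; ring

theorem fderiv_conePiece (b : ℝ) : fderiv ℝ (conePiece b) = conePieceDeriv b :=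
  funext fun q => (hasFDerivAt_conePiece b q).fderiv

theorem contDiff_conePiece (b : ℝ) : ContDiff ℝ 1 (conePiece b) := by
  rw [contDiff_one_iff_fderiv, fderiv_conePiece]
  refine ⟨fun q => (hasFDerivAt_conePiece b q).differentiableAt, ?_⟩
  unfold conePieceDeriv
  fun_prop

theorem lipschitzWith_fderiv_conePiece (b : ℝ) :
    ∃ K : ℝ≥0, LipschitzWith K (fderiv ℝ (conePiece b)) := by
  refine ⟨⟨2 + 2 * |b|, by positivity⟩, LipschitzWith.of_dist_le_mul fun p q => ?_⟩
  rw [fderiv_conePiece, dist_eq_norm, dist_eq_norm]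
  change _ ≤ (2 + 2 * |b|) * ‖p - q‖
  refine ContinuousLinearMap.opNorm_le_bound _ (by positivity) fun v => ?_
  have h : (conePieceDeriv b p - conePieceDeriv b q) v =
      -((p - q).2 * v.1) + (2 * b * (|p.2| - |q.2|) - (p - q).1) * v.2 := by
    simp [conePieceDeriv]; ring
  have h1 : |(p - q).1| ≤ ‖p - q‖ := norm_fst_le (p - q)
  have h2 : |(p - q).2| ≤ ‖p - q‖ := norm_snd_le (p - q)
  have h3 : |v.1| ≤ ‖v‖ := norm_fst_le v
  have h4 : |v.2| ≤ ‖v‖ := norm_snd_le v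
  have h5 : |(|p.2| - |q.2|)| ≤ ‖p - q‖ := (abs_abs_sub_abs_le _ _).trans h2
  have h6 : |2 * b * (|p.2| - |q.2|) - (p - q).1| ≤ 2 * |b| * ‖p - q‖ + ‖p - q‖ := by
    refine (abs_sub _ _).trans (add_le_add ?_ h1)
    rw [abs_mul, abs_mul, abs_two]
    exact mul_le_mul_of_nonneg_left h5 (by positivity)
  rw [h, Real.norm_eq_abs]
  refine (abs_add_le _ _).trans ?_
  rw [abs_neg, abs_mul, abs_mul]
  have h7 := mul_le_mul h2 h3 (abs_nonneg _) (norm_nonneg _)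
  have h8 := mul_le_mul h6 h4 (abs_nonneg _) (by positivity)
  linarith

theorem contDiffOn_conePiece (b : ℝ) :
    ContDiffOn ℝ ((⊤ : ℕ∞) : WithTop ℕ∞) (conePiece b) {q : ℝ × ℝ | q.2 ≠ 0} := by
  intro q hq
  have h1 : ContDiffAt ℝ ((⊤ : ℕ∞) : WithTop ℕ∞) (fun q : ℝ × ℝ => |q.2|) q :=
    (contDiffAt_abs hq).comp q contDiffAt_snd
  have h2 : ContDiffAt ℝ ((⊤ : ℕ∞) : WithTop ℕ∞) (conePiece b) q :=
    (contDiffAt_fst.mul contDiffAt_snd).neg.add (contDiffAt_const.mul (contDiffAt_snd.mul h1))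
  exact h2.contDiffWithinAt

/-! ### The cone of constant angle -/

section ConstantAngle

variable {θ : ℝ} {α : ℝ → ℝ} {α₀ : ℝ}

theorem foot_eq_of_const (hα : IsAngleFunction α) (h : ∀ s : ℝ, 0 ≤ s → α s = α₀) (q : ℝ × ℝ) :
    foot θ α q = max (along θ q - |across θ q| * Real.cot α₀) 0 := by
  refine foot_eq hα ⟨le_max_right _ _, ?_, fun hpos => ?_⟩
  · rw [h _ (le_max_right _ _)]
    linarith [le_max_left (along θ q - |across θ q| * Real.cot α₀) 0]
  · rw [h _ (le_max_right _ _), max_eq_left (lt_max_iff.1 hpos |>.resolve_right (lt_irrefl _)).le]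
    ring

/-- For constant angle the foot is homogeneous of degree one in `(x, y)`, hence `u = -y s` is
homogeneous of degree two. -/
theorem isCone_subgraph_ruledHeight (hα : IsAngleFunction α) (h : ∀ s : ℝ, 0 ≤ s → α s = α₀) :
    IsCone (subgraph (ruledHeight θ α)) := by
  rintro s _ ⟨p, hp, rfl⟩
  have hs := Real.exp_pos s
  have h1 : along θ (proj (dilation s p)) = Real.exp s * along θ (proj p) := by
    simp only [along, proj, dilation]; ring
  have h2 : across θ (proj (dilation s p)) = Real.exp s * across θ (proj p) := by
    simp only [across, proj, dilation]; ring
  have h3 : foot θ α (proj (dilation s p)) = Real.exp s * foot θ α (proj p) := by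
    rw [foot_eq_of_const hα h, foot_eq_of_const hα h, h1, h2, abs_mul, abs_of_pos hs,
      mul_max_of_nonneg _ _ hs.le, mul_zero, mul_sub, mul_assoc]
  have h4 : ruledHeight θ α (proj (dilation s p)) =
      Real.exp (2 * s) * ruledHeight θ α (proj p) := by
    rw [ruledHeight, ruledHeight, h2, h3, two_mul, Real.exp_add]; ring
  simp only [subgraph, mem_ofPred_eq] at hp ⊢
  rw [h4]
  exact mul_lt_mul_of_pos_left hp (Real.exp_pos _)

theorem ruledHeight_of_const (hα : IsAngleFunction α) (h : ∀ s : ℝ, 0 ≤ s → α s = α₀)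
    (x y : ℝ) :
    ruledHeight θ α (x * Real.cos θ - y * Real.sin θ, x * Real.sin θ + y * Real.cos θ) =
      if Real.cot α₀ * |y| ≤ x then conePiece (Real.cot α₀) (x, y) else 0 := by
  have h1 : along θ (x * Real.cos θ - y * Real.sin θ, x * Real.sin θ + y * Real.cos θ) = x := by
    simp only [along]; linear_combination x * Real.sin_sq_add_cos_sq θ
  have h2 : across θ (x * Real.cos θ - y * Real.sin θ, x * Real.sin θ + y * Real.cos θ) = y := by
    simp only [across]; linear_combination y * Real.sin_sq_add_cos_sq θ
  rw [ruledHeight, foot_eq_of_const hα h, h1, h2]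
  split_ifs with hxy
  · rw [max_eq_left (by linarith)]
    simp only [conePiece]; ring
  · rw [max_eq_right (by linarith)]; simp

end ConstantAngle

end Heis

theorem mainTheorem5 (θ : ℝ) (α : ℝ → ℝ)
    (hcont : ContinuousOn α (Set.Ici 0)) (hanti : AntitoneOn α (Set.Ici 0))
    (hrange : ∀ s : ℝ, 0 ≤ s → α s ∈ Set.Ioo 0 Real.pi) :
    ∃ u : ℝ × ℝ → ℝ,
      Heis.patchedSurface θ α = Heis.graph u ∧
      LocallyLipschitz u ∧
      Heis.IsAreaMinimizing (Heis.subgraph u) ∧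
      Heis.singularSet u = Heis.planarRay θ ∧
      ∀ α₀ : ℝ, (∀ s : ℝ, 0 ≤ s → α s = α₀) →
        Heis.IsCone (Heis.subgraph u) ∧
        (∀ x y : ℝ,
          u (x * Real.cos θ - y * Real.sin θ, x * Real.sin θ + y * Real.cos θ) =
            if Real.cot α₀ * |y| ≤ x then Heis.conePiece (Real.cot α₀) (x, y) else 0) ∧
        ContDiff ℝ 1 (Heis.conePiece (Real.cot α₀)) ∧
        (∃ K : NNReal, LipschitzWith K (fderiv ℝ (Heis.conePiece (Real.cot α₀)))) ∧
        ContDiffOn ℝ ((⊤ : ℕ∞) : WithTop ℕ∞) (Heis.conePiece (Real.cot α₀))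
          {q : ℝ × ℝ | q.2 ≠ 0} := by
  have hα : Heis.IsAngleFunction α := ⟨hcont, hanti, hrange⟩
  exact ⟨Heis.ruledHeight θ α, Heis.patchedSurface_eq_graph hα,
    Heis.locallyLipschitz_ruledHeight hα, Heis.isAreaMinimizing_subgraph_ruledHeight hα,
    Heis.singularSet_ruledHeight hα, fun α₀ h => ⟨Heis.isCone_subgraph_ruledHeight hα h,
      Heis.ruledHeight_of_const hα h, Heis.contDiff_conePiece _,
      Heis.lipschitzWith_fderiv_conePiece _, Heis.contDiffOn_conePiece _⟩⟩
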